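/- Let $n\ge 1$, $e\ge 2$ and $1\le k\le e-1$ be integers, and let $\zeta_e=e^{2\pi i/e}$. Let $G(e,e,n)$ be the group of monomial $n\times n$ complex matrices all of whose nonzero entries are $e$-th roots of unity and for which the product of the nonzero entries is $1$. Let $X=\{t_0,\dots,t_{e-1},s_3,\dots,s_n\}\subset G(e,e,n)$, where $$t_i=\begin{pmatrix}0&\zeta_e^{-i}&0\\ \zeta_e^{i}&0&0\\ 0&0&I_{n-2}\end{pmatrix},\qquad s_j=\begin{pmatrix}I_{j-2}&0&0&0\\0&0&1&0\\0&1&0&0\\0&0&0&I_{n-j}\end{pmatrix}$$ (there are no $t_i$ when $n=1$, so that then $X=\emptyset$). Let $\lambda=\mathrm{diag}(\zeta_e^{-(n-1)},\zeta_e,\dots,\zeta_e)\in G(e,e,n)$. Let $\ell(w)$ be the least length of a word over $X$ representing $w$. For $v,w\in G(e,e,n)$ write $v\preceq w$ (resp. $v\preceq_r w$) if $w=vu$ (resp. $w=uv$) for some $u\in G(e,e,n)$ with $\ell(w)=\ell(u)+\ell(v)$, and let $[1,w]$ and $[1,w]_r$ be the sets of $v$ with $1\preceq v\preceq w$ and $1\preceq_r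 v\preceq_r w$ respectively. The element $w$ is balanced if $[1,w]=[1,w]_r$. Call a nonzero entry of a matrix a bullet if every other entry that lies weakly above and weakly to the left of it is zero, and let $D_k$ be the set of $w\in G(e,e,n)$ whose nonzero entries other than bullets all lie in $\{1,\zeta_e^k\}$. The interval monoid $M([1,\lambda^k])$ is the monoid presented by generators $\underline{w}$, for $w\in[1,\lambda^k]$, and relations $\underline{1}=1$ and $\underline{w}=\underline{w'}\,\underline{w''}$ whenever $w,w',w''\in[1,\lambda^k]$, $w=w'w''$ and $\ell(w)=\ell(w')+\ell(w'')$. A monoid $M$ is a Garside monoid if (1) it is left and right cancellative; (2) there is $\nu:M\to\mathbb N$ with $\nu(fg)\ge\nu(f)+\nu(g)$ for all $f,g\in M$ and $\nu(g)\ne0$ for $g\neq1$; (3) any two elements of $M$ have a gcd and an lcm for left divisibility, and likewise for right divisibility; (4) $M$ has a Garside element, that is, an element $\Delta$ whose set of left divisors coincides with its set of right divisors, generates $M$ and is finite. The simples of $(M,\Delta)$ are the divisors of $\Delta$. A group of fractions of $M$ is a group in which $M$ embeds and in which every element can be written as $ab^{-1}$ and also as $c^{-1}d$ with $a,b,c,d\in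 M$. **Theorem.** The set $X$ generates $G(e,e,n)$, $[1,\lambda^k]=D_k$, the element $\lambda^k$ is balanced, and both posets $([1,\lambda^k],\preceq)$ and $([1,\lambda^k]_r,\preceq_r)$ are lattices. The monoid $M([1,\lambda^k])$ is a Garside monoid with Garside element $\underline{\lambda^k}$. The map $w\mapsto\underline{w}$ is injective on $[1,\lambda^k]$, and the simples, i.e. the divisors of $\underline{\lambda^k}$, are exactly the elements $\underline{w}$ with $w\in D_k=[1,\lambda^k]$. Moreover $M([1,\lambda^k])$ has a group of fractions. -/

import Mathlib

/-! ### Order-theoretic notions for a bare relation -/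

/-- `m` is a greatest lower bound of `a` and `b` inside `s`, for the relation `r`. -/
def IsMeetOn {α : Type*} (r : α → α → Prop) (s : Set α) (a b m : α) : Prop :=
  m ∈ s ∧ r m a ∧ r m b ∧ ∀ c ∈ s, r c a → r c b → r c m

/-- `m` is a least upper bound of `a` and `b` inside `s`, for the relation `r`. -/
def IsJoinOn {α : Type*} (r : α → α → Prop) (s : Set α) (a b m : α) : Prop :=
  m ∈ s ∧ r a m ∧ r b m ∧ ∀ c ∈ s, r a c → r b c → r m c

/-- The pair `(s, r)` is a partially ordered set which is a lattice. -/
structure IsLatticeOn {α : Type*} (r : α → α → Prop) (s : Set α) : Prop where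
  refl : ∀ a ∈ s, r a a
  antisymm : ∀ a ∈ s, ∀ b ∈ s, r a b → r b a → a = b
  trans : ∀ a ∈ s, ∀ b ∈ s, ∀ c ∈ s, r a b → r b c → r a c
  exists_meet : ∀ a ∈ s, ∀ b ∈ s, ∃ m, IsMeetOn r s a b m
  exists_join : ∀ a ∈ s, ∀ b ∈ s, ∃ m, IsJoinOn r s a b m

/-! ### Garside monoids -/

/-- Left divisibility in a monoid: `f g' = g` for some `g'`. -/
def IsLeftDivisor {M : Type*} [Monoid M] (f g : M) : Prop := ∃ g', f * g' = g

/-- Right divisibility in a monoid: `g' f = g` for some `g'`. -/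
def IsRightDivisor {M : Type*} [Monoid M] (f g : M) : Prop := ∃ g', g' * f = g

/-- `Δ` is a Garside element: its left divisors and its right divisors coincide, generate the
monoid, and are finite in number. -/
structure IsGarsideElement {M : Type*} [Monoid M] (Δ : M) : Prop where
  divisors_eq : {x : M | IsLeftDivisor x Δ} = {x : M | IsRightDivisor x Δ}
  generates : Submonoid.closure {x : M | IsLeftDivisor x Δ} = ⊤
  finite : {x : M | IsLeftDivisor x Δ}.Finite

/-- Garside monoids. Gcds and lcms are taken for left and for right divisibility. -/
structure IsGarsideMonoid (M : Type*) [Monoid M] : Prop where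
  left_cancel : ∀ f g h : M, f * g = f * h → g = h
  right_cancel : ∀ f g h : M, g * f = h * f → g = h
  exists_norm : ∃ ν : M → ℕ, (∀ f g : M, ν f + ν g ≤ ν (f * g)) ∧ ∀ g : M, g ≠ 1 → ν g ≠ 0
  exists_left_gcd : ∀ a b : M, ∃ d, IsMeetOn IsLeftDivisor Set.univ a b d
  exists_left_lcm : ∀ a b : M, ∃ m, IsJoinOn IsLeftDivisor Set.univ a b m
  exists_right_gcd : ∀ a b : M, ∃ d, IsMeetOn IsRightDivisor Set.univ a b d
  exists_right_lcm : ∀ a b : M, ∃ m, IsJoinOn IsRightDivisor Set.univ a b m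
  exists_garside : ∃ Δ : M, IsGarsideElement Δ

/-- `ι` exhibits the group `Γ` as the group of fractions of the monoid `M`: it is injective, and
every element of `Γ` is both a right fraction and a left fraction of elements of `M`. -/
structure IsGroupOfFractions {M Γ : Type*} [Monoid M] [Group Γ] (ι : M →* Γ) : Prop where
  injective : Function.Injective ι
  right_fraction : ∀ γ : Γ, ∃ a b : M, γ = ι a * (ι b)⁻¹
  left_fraction : ∀ γ : Γ, ∃ a b : M, γ = (ι a)⁻¹ * ι b

/-! ### Word length, intervals and interval monoids in a group -/

section Interval

variable {G : Type*} [Group G]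

/-- The length of `g` over `S`: the least length of a word with letters in `S` representing `g`. -/
noncomputable def wordLength (S : Set G) (g : G) : ℕ :=
  sInf {m : ℕ | ∃ l : List G, (∀ x ∈ l, x ∈ S) ∧ l.prod = g ∧ l.length = m}

/-- `f ⪯ g` : `g = f h` with `ℓ(g) = ℓ(f) + ℓ(h)`. -/
def LeftDivides (S : Set G) (f g : G) : Prop :=
  ∃ h, g = f * h ∧ wordLength S g = wordLength S f + wordLength S h

/-- `f ⪯_r g` : `g = h f` with `ℓ(g) = ℓ(h) + ℓ(f)`. -/
def RightDivides (S : Set G) (f g : G) : Prop :=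
  ∃ h, g = h * f ∧ wordLength S g = wordLength S h + wordLength S f

/-- The interval `[1, w]` for `⪯`. -/
def leftInterval (S : Set G) (w : G) : Set G := {f | LeftDivides S 1 f ∧ LeftDivides S f w}

/-- The interval `[1, w]_r` for `⪯_r`. -/
def rightInterval (S : Set G) (w : G) : Set G := {f | RightDivides S 1 f ∧ RightDivides S f w}

/-- `w` is balanced: `[1, w] = [1, w]_r`. -/
def IsBalanced (S : Set G) (w : G) : Prop := leftInterval S w = rightInterval S w

theorem wordLength_one (S : Set G) : wordLength S 1 = 0 :=
  Nat.sInf_eq_zero.2 (Or.inl ⟨[], by simp, by simp, by simp⟩)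

theorem one_mem_leftInterval (S : Set G) (w : G) : (1 : G) ∈ leftInterval S w :=
  ⟨⟨1, by simp, by simp [wordLength_one]⟩, ⟨w, by simp, by simp [wordLength_one]⟩⟩

theorem self_mem_leftInterval (S : Set G) (w : G) : w ∈ leftInterval S w :=
  ⟨⟨w, by simp, by simp [wordLength_one]⟩, ⟨1, by simp, by simp [wordLength_one]⟩⟩

/-- The defining relations of the interval monoid: the letter of `1` is the empty word, and
`f · g = h` (as words in letters) whenever `f g = h` in the group and `ℓ(f) + ℓ(g) = ℓ(h)`. -/
inductive IntervalRel (S : Set G) (w : G) :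
    FreeMonoid (leftInterval S w) → FreeMonoid (leftInterval S w) → Prop
  | one : IntervalRel S w (FreeMonoid.of ⟨1, one_mem_leftInterval S w⟩) 1
  | mul (f g h : leftInterval S w) (hmul : (f : G) * (g : G) = (h : G))
      (hlen : wordLength S (f : G) + wordLength S (g : G) = wordLength S (h : G)) :
      IntervalRel S w (FreeMonoid.of f * FreeMonoid.of g) (FreeMonoid.of h)

/-- The interval monoid `M([1, w])`, given by generators and relations. -/
abbrev IntervalMonoid (S : Set G) (w : G) : Type _ := PresentedMonoid (IntervalRel S w)

/-- The copy in `M([1, w])` of an element of `[1, w]`. -/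
def IntervalMonoid.copy (S : Set G) (w : G) (f : leftInterval S w) : IntervalMonoid S w :=
  PresentedMonoid.of (IntervalRel S w) f

end Interval

/-! ### The complex reflection group `G(e,e,n)` -/

open Equiv in
/-- The monomial matrix whose only nonzero entry in row `r` is `a r`, in column `σ r`. -/
def monomialMatrix {n : ℕ} (σ : Perm (Fin n)) (a : Fin n → ℂ) : Matrix (Fin n) (Fin n) ℂ :=
  Matrix.of fun r c => if c = σ r then a r else 0

theorem monomialMatrix_one {n : ℕ} : monomialMatrix (1 : Equiv.Perm (Fin n)) (fun _ => 1) = 1 := by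
  ext r c
  simp [monomialMatrix, Matrix.one_apply, eq_comm]

theorem monomialMatrix_mul {n : ℕ} (σ τ : Equiv.Perm (Fin n)) (a b : Fin n → ℂ) :
    monomialMatrix σ a * monomialMatrix τ b
      = monomialMatrix (τ * σ) (fun r => a r * b (σ r)) := by
  ext r c
  simp only [monomialMatrix, Matrix.mul_apply, Matrix.of_apply, Equiv.Perm.mul_apply]
  rw [Finset.sum_eq_single (σ r)]
  · by_cases h : c = τ (σ r) <;> simp [h]
  · intro j _ hj
    simp [hj]
  · simp

/-- The monomial matrix with nonzero coefficients `a`, as an invertible matrix. -/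
noncomputable def monomialGL {n : ℕ} (σ : Equiv.Perm (Fin n)) (a : Fin n → ℂ) (ha : ∀ i, a i ≠ 0) :
    GL (Fin n) ℂ where
  val := monomialMatrix σ a
  inv := monomialMatrix σ⁻¹ (fun r => (a (σ⁻¹ r))⁻¹)
  val_inv := by
    rw [monomialMatrix_mul, ← monomialMatrix_one]
    congr 1
    · simp
    · funext r
      simp [ha]
  inv_val := by
    rw [monomialMatrix_mul, ← monomialMatrix_one]
    congr 1
    · simp
    · funext r
      simp [ha]

/-- The group `G(e,e,n)` (for `e ≥ 1`) of monomial `n × n` matrices whose nonzero entries are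
`e`-th roots of unity with product `1`. -/
def Geen (e n : ℕ) : Subgroup (GL (Fin n) ℂ) where
  carrier := {g | ∃ (σ : Equiv.Perm (Fin n)) (a : Fin n → ℂ),
    (∀ i, a i ≠ 0) ∧ (∀ i, a i ^ e = 1) ∧ ∏ i, a i = 1 ∧
    (g : Matrix (Fin n) (Fin n) ℂ) = monomialMatrix σ a}
  one_mem' := ⟨1, fun _ => 1, by simp, by simp, by simp, by simp [monomialMatrix_one]⟩
  mul_mem' := by
    rintro g h ⟨σ, a, ha, hae, hap, hg⟩ ⟨τ, b, hb, hbe, hbp, hh⟩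
    refine ⟨τ * σ, fun r => a r * b (σ r), fun i => mul_ne_zero (ha i) (hb _), fun i => ?_, ?_, ?_⟩
    · rw [mul_pow, hae, hbe, one_mul]
    · rw [Finset.prod_mul_distrib, hap, Equiv.prod_comp σ b, hbp, one_mul]
    · rw [Units.val_mul, hg, hh, monomialMatrix_mul]
  inv_mem' := by
    rintro g ⟨σ, a, ha, hae, hap, hg⟩
    have h : g = monomialGL σ a ha := Units.ext hg
    refine ⟨σ⁻¹, fun r => (a (σ⁻¹ r))⁻¹, fun i => inv_ne_zero (ha _), fun i => ?_, ?_, ?_⟩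
    · rw [inv_pow, hae, inv_one]
    · rw [Finset.prod_inv_distrib, Equiv.prod_comp σ⁻¹ a, hap, inv_one]
    · rw [h]
      rfl

namespace Geen

/-- The primitive `e`-th root of unity `exp(2πi/e)`. -/
noncomputable def zeta (e : ℕ) : ℂ := Complex.exp (2 * Real.pi * Complex.I / e)

theorem zeta_ne_zero (e : ℕ) : zeta e ≠ 0 := Complex.exp_ne_zero _

theorem zeta_pow (e : ℕ) : zeta e ^ e = 1 := by
  rcases Nat.eq_zero_or_pos e with rfl | h
  · simp
  · exact (Complex.isPrimitiveRoot_exp e h.ne').pow_eq_one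

theorem zeta_zpow_pow (e : ℕ) (m : ℤ) : (zeta e ^ m) ^ e = 1 := by
  rw [← zpow_natCast, ← zpow_mul, mul_comm, zpow_mul, zpow_natCast, zeta_pow, one_zpow]

/-- The element of `G(e,e,n)` with entry `ζ_e ^ m r` in row `r` and column `σ r`, all other
entries being zero, where the exponents `m r` have sum `0`. -/
noncomputable def ofExponents (e : ℕ) {n : ℕ} (σ : Equiv.Perm (Fin n)) (m : Fin n → ℤ)
    (hm : ∑ i, m i = 0) : Geen e n :=
  ⟨monomialGL σ (fun r => zeta e ^ m r) (fun _ => zpow_ne_zero _ (zeta_ne_zero e)),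
    σ, fun r => zeta e ^ m r, fun _ => zpow_ne_zero _ (zeta_ne_zero e),
    fun _ => zeta_zpow_pow e _, by
      have key : ∀ s : Finset (Fin n), ∏ i ∈ s, zeta e ^ m i = zeta e ^ (∑ i ∈ s, m i) := by
        intro s
        induction s using Finset.cons_induction with
        | empty => simp
        | cons a s ha ih =>
          rw [Finset.prod_cons, Finset.sum_cons, ih, zpow_add₀ (zeta_ne_zero e)]
      rw [key, hm, zpow_zero], rfl⟩

/-- The matrix of an element of `G(e,e,n)`. -/
def toMatrix {e n : ℕ} (w : Geen e n) : Matrix (Fin n) (Fin n) ℂ :=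
  ((w : GL (Fin n) ℂ) : Matrix (Fin n) (Fin n) ℂ)

/-- The generator `t_i`: rows (and columns) number 1 and 2 are exchanged, with entry `ζ_e ^ (-i)`
in row 1 and `ζ_e ^ i` in row 2; it is the identity on the other coordinates. -/
noncomputable def t (e : ℕ) {n : ℕ} (hn : 2 ≤ n) (i : ℕ) : Geen e n :=
  ofExponents e (Equiv.swap (⟨0, by omega⟩ : Fin n) ⟨1, by omega⟩)
    (fun r => if r.val = 0 then -(i : ℤ) else if r.val = 1 then (i : ℤ) else 0) (by
      obtain ⟨p, rfl⟩ := Nat.exists_eq_add_of_le' hn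
      simp [Fin.sum_univ_succ])

/-- The generator `s_j`, `3 ≤ j ≤ n`: the permutation matrix exchanging the coordinates number
`j - 1` and `j` (in the numbering `1, …, n`). -/
noncomputable def s (e : ℕ) {n : ℕ} (j : ℕ) (h3 : 3 ≤ j) (hjn : j ≤ n) : Geen e n :=
  ofExponents e (Equiv.swap (⟨j - 2, by omega⟩ : Fin n) ⟨j - 1, by omega⟩) (fun _ => 0) (by simp)

/-- The generating set `X = {t_0, …, t_{e-1}, s_3, …, s_n}`. -/
def X (e n : ℕ) : Set (Geen e n) :=
  {x | (∃ (hn : 2 ≤ n) (i : ℕ), i < e ∧ x = t e hn i) ∨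
    ∃ (j : ℕ) (h3 : 3 ≤ j) (hjn : j ≤ n), x = s e j h3 hjn}

/-- The diagonal matrix `λ = diag(ζ_e ^ (-(n-1)), ζ_e, …, ζ_e)`. -/
noncomputable def lam (e n : ℕ) : Geen e n :=
  ofExponents e 1 (fun r => if r.val = 0 then 1 - (n : ℤ) else 1) (by
    rcases n with _ | n
    · simp
    · simp [Fin.sum_univ_succ])

/-- The entry of `w` in position `(i, c)` is a bullet: it is nonzero, and every other entry weakly
above and weakly to the left of it is zero. -/
def IsBullet {e n : ℕ} (w : Geen e n) (i c : Fin n) : Prop :=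
  toMatrix w i c ≠ 0 ∧
    ∀ i' c' : Fin n, i' ≤ i → c' ≤ c → (i', c') ≠ (i, c) → toMatrix w i' c' = 0

/-- The set `D_k` of those `w` whose nonzero entries other than the bullets are `1` or `ζ_e ^ k`. -/
def D (e n k : ℕ) : Set (Geen e n) :=
  {w | ∀ i c : Fin n, toMatrix w i c ≠ 0 → ¬ IsBullet w i c →
    toMatrix w i c = 1 ∨ toMatrix w i c = zeta e ^ k}

end Geen

/-! The proof has a combinatorial half about monomial matrices and a general half about interval
monoids.

Combinatorics. The length of `w` is a sum over pairs of rows `r < s`: 1 if the nonzero entries of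
the two rows are inverted, and otherwise 0 or 2 according as the entry of row `s` is 1 or not
(`wordLength_eq_len`). The triangle inequality `len w ≤ len v + len (v⁻¹ * w)` already holds pair by
pair, so `v ⪯ w` amounts to a condition on each pair (`leftDivides_X_iff`). For `λ^k` the condition
becomes membership in `D_k`; this uses `ζ_e^k ≠ 1`. Inversion exchanges `D_k` with `D_{e-k}`, and
`λ^{-k} = λ^{e-k}`, so `λ^k` is balanced. Joins of two generators are written down explicitly
(`exists_join_of_le`). In a balanced interval they yield all joins, and joins yield meets.

General half. Let `w` be balanced, with `[1, w]` and `[1, w⁻¹]` lattices. The monoid acts on pairs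
(head, tail): `f` absorbs as much of the head as fits in `[1, w]` and pushes the rest into the tail.
Acting on the trivial pair gives a normal form from which `m` can be read off `f m`. This yields
left cancellation, and lcms of copies of interval elements; arbitrary lcms are tiled from these, and
gcds follow by maximality of length. The right-hand statements are the left-hand ones for the
opposite monoid, which is presented by `[1, w⁻¹]`. Cancellation and common multiples then give a
group of fractions by Ore localization. -/

section WordLength

/-! ### Word length, divisibility and lattice criteria in a group -/

variable {G : Type*} [Group G] {S : Set G}

/-- `S` is closed under inversion and generates the group. -/
structure IsSymmGenerating (S : Set G) : Prop where
  closure_eq : Submonoid.closure S = ⊤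
  inv_mem : ∀ x ∈ S, x⁻¹ ∈ S

theorem wordLength_prod_le {l : List G} (hl : ∀ x ∈ l, x ∈ S) : wordLength S l.prod ≤ l.length :=
  Nat.sInf_le ⟨l, hl, rfl, rfl⟩

namespace IsSymmGenerating

theorem exists_word (hS : IsSymmGenerating S) (g : G) :
    ∃ l : List G, (∀ x ∈ l, x ∈ S) ∧ l.prod = g ∧ l.length = wordLength S g := by
  have hg : g ∈ Submonoid.closure S := hS.closure_eq ▸ Submonoid.mem_top g
  obtain ⟨l, hl, hlg⟩ := Submonoid.exists_list_of_mem_closure hg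
  exact Nat.sInf_mem (s := {m : ℕ | ∃ l : List G, (∀ x ∈ l, x ∈ S) ∧ l.prod = g ∧ l.length = m})
    ⟨l.length, l, hl, hlg, rfl⟩

theorem wordLength_mul_le (hS : IsSymmGenerating S) (g h : G) :
    wordLength S (g * h) ≤ wordLength S g + wordLength S h := by
  obtain ⟨l, hl, rfl, hlen⟩ := hS.exists_word g
  obtain ⟨m, hm, rfl, hmen⟩ := hS.exists_word h
  rw [← hlen, ← hmen, ← List.prod_append, ← List.length_append]
  exact wordLength_prod_le fun x hx => (List.mem_append.1 hx).elim (hl x) (hm x)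

theorem wordLength_inv_le (hS : IsSymmGenerating S) (g : G) :
    wordLength S g⁻¹ ≤ wordLength S g := by
  obtain ⟨l, hl, rfl, hlen⟩ := hS.exists_word g
  rw [← hlen, List.prod_inv_reverse]
  refine (wordLength_prod_le fun x hx => ?_).trans (by simp)
  simp only [List.mem_reverse, List.mem_map] at hx
  obtain ⟨y, hy, rfl⟩ := hx
  exact hS.inv_mem y (hl y hy)

theorem wordLength_inv (hS : IsSymmGenerating S) (g : G) : wordLength S g⁻¹ = wordLength S g :=
  (hS.wordLength_inv_le g).antisymm (by simpa using hS.wordLength_inv_le g⁻¹)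

theorem eq_one_of_wordLength_eq_zero (hS : IsSymmGenerating S) {g : G} (hg : wordLength S g = 0) :
    g = 1 := by
  obtain ⟨l, -, rfl, hlen⟩ := hS.exists_word g
  rw [hg, List.length_eq_zero_iff] at hlen
  simp [hlen]

end IsSymmGenerating

theorem leftDivides_iff {f g : G} :
    LeftDivides S f g ↔ wordLength S g = wordLength S f + wordLength S (f⁻¹ * g) := by
  refine ⟨?_, fun h => ⟨f⁻¹ * g, by simp, h⟩⟩
  rintro ⟨h, rfl, hl⟩
  simpa using hl

theorem leftDivides_mul_iff {f h : G} :
    LeftDivides S f (f * h) ↔ wordLength S (f * h) = wordLength S f + wordLength S h := by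
  simp [leftDivides_iff]

theorem LeftDivides.wordLength_le {f g : G} (h : LeftDivides S f g) :
    wordLength S f ≤ wordLength S g := by
  rw [leftDivides_iff] at h
  omega

theorem one_leftDivides (f : G) : LeftDivides S 1 f := by simp [leftDivides_iff, wordLength_one]

theorem leftDivides_refl (f : G) : LeftDivides S f f := by simp [leftDivides_iff, wordLength_one]

theorem mem_leftInterval {f w : G} : f ∈ leftInterval S w ↔ LeftDivides S f w :=
  ⟨fun h => h.2, fun h => ⟨one_leftDivides f, h⟩⟩

namespace IsSymmGenerating

theorem leftDivides_trans (hS : IsSymmGenerating S) {f g h : G} (hfg : LeftDivides S f g)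
    (hgh : LeftDivides S g h) : LeftDivides S f h := by
  rw [leftDivides_iff] at *
  have h1 := hS.wordLength_mul_le (f⁻¹ * g) (g⁻¹ * h)
  have h2 := hS.wordLength_mul_le f (f⁻¹ * h)
  simp only [mul_assoc, mul_inv_cancel_left] at h1 h2
  omega

theorem eq_of_leftDivides_of_le (hS : IsSymmGenerating S) {f g : G} (hfg : LeftDivides S f g)
    (hl : wordLength S g ≤ wordLength S f) : f = g := by
  rw [leftDivides_iff] at hfg
  exact inv_mul_eq_one.1 (hS.eq_one_of_wordLength_eq_zero (by omega))

theorem leftDivides_antisymm (hS : IsSymmGenerating S) {f g : G} (hfg : LeftDivides S f g)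
    (hgf : LeftDivides S g f) : f = g :=
  hS.eq_of_leftDivides_of_le hfg hgf.wordLength_le

/-- Left translation by `z` of the divisors of `b`, when `z b` is reduced. -/
theorem mul_leftDivides_mul_iff (hS : IsSymmGenerating S) {z a b : G}
    (hzb : LeftDivides S z (z * b)) :
    LeftDivides S a b ↔ LeftDivides S z (z * a) ∧ LeftDivides S (z * a) (z * b) := by
  have e1 : (z * a)⁻¹ * (z * b) = a⁻¹ * b := by group
  rw [leftDivides_mul_iff] at hzb ⊢
  rw [leftDivides_iff, leftDivides_iff, e1]
  have h1 := hS.wordLength_mul_le z a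
  have h2 := hS.wordLength_mul_le (z * a) (a⁻¹ * b)
  simp only [mul_assoc, mul_inv_cancel_left] at h2
  omega

theorem leftDivides_of_mul (hS : IsSymmGenerating S) {z a b : G} (hza : LeftDivides S z (z * a))
    (hab : LeftDivides S (z * a) (z * b)) : LeftDivides S a b :=
  (hS.mul_leftDivides_mul_iff (hS.leftDivides_trans hza hab)).2 ⟨hza, hab⟩

theorem exists_generator_leftDivides (hS : IsSymmGenerating S) {g : G} (hg : g ≠ 1) :
    ∃ x ∈ S, wordLength S x = 1 ∧ LeftDivides S x g := by
  obtain ⟨l, hl, hlg, hlen⟩ := hS.exists_word g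
  cases l with
  | nil => exact absurd hlg.symm hg
  | cons x l =>
    simp only [List.prod_cons, List.length_cons] at hlg hlen
    have h1 : wordLength S x ≤ 1 := by
      simpa using wordLength_prod_le (S := S) (l := [x]) (by simpa using hl x (by simp))
    have h2 : wordLength S l.prod ≤ l.length :=
      wordLength_prod_le fun y hy => hl y (List.mem_cons_of_mem x hy)
    have h3 := hS.wordLength_mul_le x l.prod
    rw [hlg] at h3
    refine ⟨x, hl x (by simp), by omega, l.prod, hlg.symm, by omega⟩

theorem rightDivides_iff_inv (hS : IsSymmGenerating S) {f g : G} :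
    RightDivides S f g ↔ LeftDivides S f⁻¹ g⁻¹ := by
  constructor
  · rintro ⟨h, rfl, hl⟩
    exact ⟨h⁻¹, by simp, by simp only [hS.wordLength_inv]; omega⟩
  · rintro ⟨h, hg, hl⟩
    refine ⟨h⁻¹, by simpa using congrArg (·⁻¹) hg, ?_⟩
    simp only [hS.wordLength_inv] at hl ⊢
    omega

theorem mem_rightInterval (hS : IsSymmGenerating S) {f w : G} :
    f ∈ rightInterval S w ↔ f⁻¹ ∈ leftInterval S w⁻¹ := by
  rw [mem_leftInterval, ← hS.rightDivides_iff_inv]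
  exact ⟨fun h => h.2, fun h => ⟨hS.rightDivides_iff_inv.2 (by simpa using one_leftDivides _), h⟩⟩

theorem mem_leftInterval_of_leftDivides (hS : IsSymmGenerating S) {f g w : G}
    (hfg : LeftDivides S f g) (hg : g ∈ leftInterval S w) : f ∈ leftInterval S w :=
  mem_leftInterval.2 (hS.leftDivides_trans hfg (mem_leftInterval.1 hg))

theorem inv_mem_leftInterval_inv (hS : IsSymmGenerating S) {w : G} (hw : IsBalanced S w) {f : G} :
    f⁻¹ ∈ leftInterval S w⁻¹ ↔ f ∈ leftInterval S w := by
  rw [← hS.mem_rightInterval, hw]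

theorem isBalanced_inv (hS : IsSymmGenerating S) {w : G} (hw : IsBalanced S w) :
    IsBalanced S w⁻¹ := by
  ext f
  rw [hS.mem_rightInterval, inv_inv, ← hS.inv_mem_leftInterval_inv hw, inv_inv]

/-- Inversion turns `g` into a left divisor of `(f * g)⁻¹`, which lies in `[1, w⁻¹]` because `w` is
balanced. -/
theorem right_factor_mem (hS : IsSymmGenerating S) {w : G} (hw : IsBalanced S w) {f g : G}
    (hfg : f * g ∈ leftInterval S w) (hl : LeftDivides S f (f * g)) : g ∈ leftInterval S w := by
  rw [← hS.inv_mem_leftInterval_inv hw] at hfg ⊢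
  refine hS.mem_leftInterval_of_leftDivides ?_ hfg
  rw [leftDivides_mul_iff] at hl
  refine ⟨f⁻¹, by simp, ?_⟩
  simp only [hS.wordLength_inv]
  omega

theorem isLatticeOn_rightInterval (hS : IsSymmGenerating S) {w : G}
    (h : IsLatticeOn (LeftDivides S) (leftInterval S w⁻¹)) :
    IsLatticeOn (RightDivides S) (rightInterval S w) := by
  have hmem {f : G} := hS.mem_rightInterval (f := f) (w := w)
  have hdiv {f g : G} := hS.rightDivides_iff_inv (f := f) (g := g)
  refine ⟨fun a ha => hdiv.2 (leftDivides_refl _), fun a _ b _ hab hba => ?_,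
    fun a _ b _ c _ hab hbc => hdiv.2 (hS.leftDivides_trans (hdiv.1 hab) (hdiv.1 hbc)),
    fun a ha b hb => ?_, fun a ha b hb => ?_⟩
  · exact inv_injective (hS.leftDivides_antisymm (hdiv.1 hab) (hdiv.1 hba))
  · obtain ⟨m, h1, h2, h3, h4⟩ := h.exists_meet _ (hmem.1 ha) _ (hmem.1 hb)
    exact ⟨m⁻¹, hmem.2 (by simpa using h1), hdiv.2 (by simpa using h2), hdiv.2 (by simpa using h3),
      fun c hc hca hcb => hdiv.2 (by simpa using h4 _ (hmem.1 hc) (hdiv.1 hca) (hdiv.1 hcb))⟩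
  · obtain ⟨m, h1, h2, h3, h4⟩ := h.exists_join _ (hmem.1 ha) _ (hmem.1 hb)
    exact ⟨m⁻¹, hmem.2 (by simpa using h1), hdiv.2 (by simpa using h2), hdiv.2 (by simpa using h3),
      fun c hc hca hcb => hdiv.2 (by simpa using h4 _ (hmem.1 hc) (hdiv.1 hca) (hdiv.1 hcb))⟩

/-- If any two generators in a balanced interval have a join, then so do any two elements. -/
theorem exists_isJoinOn_of_generators (hS : IsSymmGenerating S) {w : G} (hw : IsBalanced S w)
    (hjoin : ∀ x ∈ S, ∀ y ∈ S, x ∈ leftInterval S w → y ∈ leftInterval S w →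
      ∃ m, IsJoinOn (LeftDivides S) (leftInterval S w) x y m)
    (d : ℕ) (z a b : G) (hd : wordLength S w ≤ wordLength S z + d) (ha : a ∈ leftInterval S w)
    (hb : b ∈ leftInterval S w) (hza : LeftDivides S z a) (hzb : LeftDivides S z b) :
    ∃ m, IsJoinOn (LeftDivides S) (leftInterval S w) a b m := by
  -- Here `z` is a common left divisor of `a` and `b`, and `d` bounds `ℓ(w) - ℓ(z)`; the induction
  -- moves `z` upwards.
  induction d generalizing z a b with
  | zero =>
    have hz := (hS.leftDivides_trans hza (mem_leftInterval.1 ha))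
    obtain rfl := hS.eq_of_leftDivides_of_le hz hd
    obtain rfl := hS.leftDivides_antisymm hza (mem_leftInterval.1 ha)
    exact ⟨b, hb, hzb, leftDivides_refl _, fun c _ _ h => h⟩
  | succ d ih =>
    obtain ⟨a, rfl⟩ : ∃ a', a = z * a' := ⟨z⁻¹ * a, by simp⟩
    obtain ⟨b, rfl⟩ : ∃ b', b = z * b' := ⟨z⁻¹ * b, by simp⟩
    by_cases ha1 : a = 1
    · exact ⟨z * b, hb, by simpa [ha1] using hzb, leftDivides_refl _, fun c _ _ h => h⟩
    by_cases hb1 : b = 1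
    · exact ⟨z * a, ha, leftDivides_refl _, by simpa [hb1] using hza, fun c _ h _ => h⟩
    obtain ⟨x, hx, hx1, hxa⟩ := hS.exists_generator_leftDivides ha1
    obtain ⟨y, hy, hy1, hyb⟩ := hS.exists_generator_leftDivides hb1
    obtain ⟨hzx, hzxa⟩ := (hS.mul_leftDivides_mul_iff hza).1 hxa
    obtain ⟨hzy, hzyb⟩ := (hS.mul_leftDivides_mul_iff hzb).1 hyb
    obtain ⟨j, hj, hxj, hyj, hjmin⟩ := hjoin x hx y hy
      (hS.right_factor_mem hw (hS.mem_leftInterval_of_leftDivides hzxa ha) hzx)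
      (hS.right_factor_mem hw (hS.mem_leftInterval_of_leftDivides hzyb hb) hzy)
    -- Translation by `z`: a common multiple of `z x` and `z y` in the interval is a reduced product
    -- `z c` with `c` in the interval by balance, so `j ⪯ c`.
    have key : ∀ c ∈ leftInterval S w, LeftDivides S (z * x) c → LeftDivides S (z * y) c →
        LeftDivides S z (z * j) ∧ LeftDivides S (z * j) c := by
      intro c hc hxc hyc
      obtain ⟨c, rfl⟩ : ∃ c', c = z * c' := ⟨z⁻¹ * c, by simp⟩
      have hzc := hS.leftDivides_trans hzx hxc
      rw [← hS.mul_leftDivides_mul_iff hzc]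
      exact hjmin c (hS.right_factor_mem hw hc hzc) (hS.leftDivides_of_mul hzx hxc)
        (hS.leftDivides_of_mul hzy hyc)
    obtain ⟨hzj, hzjw⟩ := key w (self_mem_leftInterval S w)
      (hS.leftDivides_trans hzxa (mem_leftInterval.1 ha))
      (hS.leftDivides_trans hzyb (mem_leftInterval.1 hb))
    have hzxj := ((hS.mul_leftDivides_mul_iff hzj).1 hxj).2
    have hzyj := ((hS.mul_leftDivides_mul_iff hzj).1 hyj).2
    have hlx := leftDivides_mul_iff.1 hzx
    have hly := leftDivides_mul_iff.1 hzy
    -- Two joins over longer bases suffice: `a` with `z j` above `z x`, and then the result with `b`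
    -- above `z y`.
    obtain ⟨u, hu, hau, hju, humin⟩ := ih (z * x) (z * a) (z * j) (by omega) ha
      (mem_leftInterval.2 hzjw) hzxa hzxj
    obtain ⟨v, hv, hbv, huv, hvmin⟩ := ih (z * y) (z * b) u (by omega) hb hu hzyb
      (hS.leftDivides_trans hzyj hju)
    exact ⟨v, hv, hS.leftDivides_trans hau huv, hbv, fun c hc hac hbc => hvmin c hc hbc
      (humin c hc hac (key c hc (hS.leftDivides_trans hzxa hac)
        (hS.leftDivides_trans hzyb hbc)).2)⟩

/-- A balanced interval in which any two generators have a join is a lattice. -/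
theorem isLatticeOn_leftInterval (hS : IsSymmGenerating S) {w : G} (hw : IsBalanced S w)
    (hjoin : ∀ x ∈ S, ∀ y ∈ S, x ∈ leftInterval S w → y ∈ leftInterval S w →
      ∃ m, IsJoinOn (LeftDivides S) (leftInterval S w) x y m) :
    IsLatticeOn (LeftDivides S) (leftInterval S w) := by
  have hj : ∀ a ∈ leftInterval S w, ∀ b ∈ leftInterval S w,
      ∃ m, IsJoinOn (LeftDivides S) (leftInterval S w) a b m := fun a ha b hb =>
    hS.exists_isJoinOn_of_generators hw hjoin _ 1 a b (Nat.le_add_left _ _) ha hb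
      (one_leftDivides a) (one_leftDivides b)
  refine ⟨fun a _ => leftDivides_refl a, fun a _ b _ => hS.leftDivides_antisymm,
    fun a _ b _ c _ => hS.leftDivides_trans, fun a ha b hb => ?_, hj⟩
  -- The meet is a common divisor `d` of maximal length: its join with another common divisor still
  -- divides `a` and `b`, hence equals `d`.
  let T : Set ℕ := {m | ∃ d, LeftDivides S d a ∧ LeftDivides S d b ∧ wordLength S d = m}
  have hT : BddAbove T := ⟨wordLength S a, by rintro _ ⟨d, hda, -, rfl⟩; exact hda.wordLength_le⟩
  obtain ⟨d, hda, hdb, hd⟩ :=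
    Nat.sSup_mem (s := T) ⟨_, 1, one_leftDivides a, one_leftDivides b, rfl⟩ hT
  have hdw := hS.mem_leftInterval_of_leftDivides hda ha
  refine ⟨d, hdw, hda, hdb, fun c hc hca hcb => ?_⟩
  obtain ⟨m, -, hcm, hdm, hmin⟩ := hj c hc d hdw
  have hm : wordLength S m ≤ wordLength S d :=
    hd ▸ le_csSup hT ⟨m, hmin a ha hca hda, hmin b hb hcb hdb, rfl⟩
  rwa [hS.eq_of_leftDivides_of_le hdm hm]

end IsSymmGenerating

end WordLength

/-! ### From a balanced lattice interval to a Garside monoid -/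

section IntervalPresentation

variable {G : Type} [Group G] {S : Set G} {w : G} {M : Type} [Monoid M] {c : G → M}

/-- `M` is presented by the symbols `c f`, for `f` in `[1, w]`, subject to the relations
`c (f g) = c f · c g` for the reduced products `f g` in `[1, w]`. -/
structure IsIntervalPresentation (S : Set G) (w : G) (c : G → M) : Prop where
  one : c 1 = 1
  mul : ∀ f ∈ leftInterval S w, ∀ g ∈ leftInterval S w, f * g ∈ leftInterval S w →
    LeftDivides S f (f * g) → c (f * g) = c f * c g
  generates : Submonoid.closure (c '' leftInterval S w) = ⊤
  lift : ∀ {N : Type} [Monoid N] (F : G → N), F 1 = 1 →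
    (∀ f ∈ leftInterval S w, ∀ g ∈ leftInterval S w, f * g ∈ leftInterval S w →
      LeftDivides S f (f * g) → F (f * g) = F f * F g) →
    ∃ φ : M →* N, ∀ f ∈ leftInterval S w, φ (c f) = F f

/-- `h` is the greatest left divisor of `p` such that `f h` is a reduced product in `[1, w]`. -/
structure IsTransfer (S : Set G) (w f p h : G) : Prop where
  dvd : LeftDivides S h p
  mem : f * h ∈ leftInterval S w
  reduced : LeftDivides S f (f * h)
  greatest : ∀ h', LeftDivides S h' p → f * h' ∈ leftInterval S w → LeftDivides S f (f * h') →
    LeftDivides S h' h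

/-- A generating set and an element fulfilling the conditions for an interval Garside structure. -/
structure IsGarsideInterval (S : Set G) (w : G) : Prop extends IsSymmGenerating S where
  balanced : IsBalanced S w
  lattice : IsLatticeOn (LeftDivides S) (leftInterval S w)
  lattice_inv : IsLatticeOn (LeftDivides S) (leftInterval S w⁻¹)

namespace IsGarsideInterval

theorem inv (h : IsGarsideInterval S w) : IsGarsideInterval S w⁻¹ :=
  ⟨h.toIsSymmGenerating, h.isBalanced_inv h.balanced, h.lattice_inv, by simpa using h.lattice⟩

/-- The product `f h` is reduced and in `[1, w]` exactly when `h` divides the complement `f⁻¹ w`, so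
the transfer is the meet of `p` with that complement. -/
theorem exists_isTransfer (H : IsGarsideInterval S w) {f p : G} (hf : f ∈ leftInterval S w)
    (hp : p ∈ leftInterval S w) : ∃ h, IsTransfer S w f p h := by
  have hfw : LeftDivides S f (f * (f⁻¹ * w)) := by simpa using mem_leftInterval.1 hf
  have hw : f⁻¹ * w ∈ leftInterval S w :=
    H.right_factor_mem H.balanced (by simpa using self_mem_leftInterval S w) hfw
  have key : ∀ h, LeftDivides S h (f⁻¹ * w) ↔
      LeftDivides S f (f * h) ∧ f * h ∈ leftInterval S w := by
    intro h
    rw [H.mul_leftDivides_mul_iff hfw, mul_inv_cancel_left, mem_leftInterval]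
  obtain ⟨h, -, hhp, hhw, hmax⟩ := H.lattice.exists_meet p hp _ hw
  exact ⟨h, hhp, ((key h).1 hhw).2, ((key h).1 hhw).1, fun h' hp' hm hr =>
    hmax h' (H.mem_leftInterval_of_leftDivides hp' hp) hp' ((key h').2 ⟨hr, hm⟩)⟩

end IsGarsideInterval

theorem IsTransfer.eq (hS : IsSymmGenerating S) {f p h h' : G} (H : IsTransfer S w f p h)
    (H' : IsTransfer S w f p h') : h = h' :=
  hS.leftDivides_antisymm (H'.greatest h H.dvd H.mem H.reduced)
    (H.greatest h' H'.dvd H'.mem H'.reduced)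

/-- Transfers for a reduced product `f g`. -/
theorem IsTransfer.of_mul (hS : IsGarsideInterval S w) {f g p h h₁ h₂ : G}
    (hred : LeftDivides S f (f * g))
    (H : IsTransfer S w (f * g) p h) (H₂ : IsTransfer S w g p h₂)
    (H₁ : IsTransfer S w f (g * h₂) h₁) : h₁ = g * h ∧ LeftDivides S h h₂ := by
  have hm : f * (g * h) ∈ leftInterval S w := by simpa [mul_assoc] using H.mem
  have hr : LeftDivides S (f * g) (f * (g * h)) := by simpa [mul_assoc] using H.reduced
  have hr' := hS.leftDivides_trans hred hr
  have hgh : LeftDivides S g (g * h) := hS.leftDivides_of_mul hred hr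
  have hhh : LeftDivides S h h₂ :=
    H₂.greatest h H.dvd (hS.right_factor_mem hS.balanced hm hr') hgh
  -- `g h` competes with `h₁`, so it divides `h₁`; conversely `g` divides `h₁`, and the cofactor
  -- competes with `h`.
  refine ⟨?_, hhh⟩
  have h1 : LeftDivides S (g * h) h₁ :=
    H₁.greatest _ ((hS.mul_leftDivides_mul_iff H₂.reduced).1 hhh).2 hm hr'
  refine hS.leftDivides_antisymm ?_ h1
  obtain ⟨h', rfl⟩ : ∃ h', h₁ = g * h' := ⟨g⁻¹ * h₁, by simp⟩
  have hgh' := hS.leftDivides_trans hgh h1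
  have h2 : LeftDivides S h' h := by
    refine H.greatest h' (hS.leftDivides_trans (hS.leftDivides_of_mul hgh' H₁.dvd) H₂.dvd)
      (by simpa [mul_assoc] using H₁.mem) ?_
    simpa [mul_assoc] using ((hS.mul_leftDivides_mul_iff H₁.reduced).1 hgh').2
  exact ((hS.mul_leftDivides_mul_iff hgh).1 h2).2

namespace IsIntervalPresentation

theorem mul_of_mul_mem (hc : IsIntervalPresentation S w c) (H : IsGarsideInterval S w) {f g : G}
    (hfg : f * g ∈ leftInterval S w) (hred : LeftDivides S f (f * g)) :
    c (f * g) = c f * c g :=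
  hc.mul f (H.mem_leftInterval_of_leftDivides hred hfg) g
    (H.right_factor_mem H.balanced hfg hred) hfg hred

theorem mul_of_leftDivides (hc : IsIntervalPresentation S w c) (H : IsGarsideInterval S w) {f g : G}
    (hg : g ∈ leftInterval S w) (hfg : LeftDivides S f g) : c f * c (f⁻¹ * g) = c g := by
  rw [← hc.mul_of_mul_mem H (by simpa using hg) (by simpa using hfg), mul_inv_cancel_left]

@[elab_as_elim]
theorem induction_left (hc : IsIntervalPresentation S w c) {motive : M → Prop} (one : motive 1)
    (mul : ∀ f ∈ leftInterval S w, ∀ m, motive m → motive (c f * m)) (m : M) : motive m := by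
  have hm : m ∈ Submonoid.closure (c '' leftInterval S w) := hc.generates ▸ Submonoid.mem_top m
  induction hm using Submonoid.closure_induction_left with
  | one => exact one
  | mul_left x hx y _ ih =>
    obtain ⟨f, hf, rfl⟩ := hx
    exact mul f hf y ih

theorem exists_toGroup (hc : IsIntervalPresentation S w c) :
    ∃ π : M →* G, ∀ f ∈ leftInterval S w, π (c f) = f :=
  hc.lift id rfl fun _ _ _ _ _ _ => rfl

theorem exists_length (hc : IsIntervalPresentation S w c) :
    ∃ ν : M → ℕ, ν 1 = 0 ∧ (∀ a b, ν (a * b) = ν a + ν b) ∧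
      ∀ f ∈ leftInterval S w, ν (c f) = wordLength S f := by
  obtain ⟨φ, hφ⟩ := hc.lift (fun g => Multiplicative.ofAdd (wordLength S g))
    (by simp [wordLength_one]) fun f _ g _ _ h => by
      rw [leftDivides_mul_iff.1 h, ofAdd_add]
  exact ⟨fun m => (φ m).toAdd, by simp, by simp, fun f hf => by simp [hφ f hf]⟩

theorem eq_one_of_length_eq_zero (hc : IsIntervalPresentation S w c) (hS : IsSymmGenerating S)
    {ν : M → ℕ} (hmul : ∀ a b, ν (a * b) = ν a + ν b)
    (hcop : ∀ f ∈ leftInterval S w, ν (c f) = wordLength S f) (m : M) (hm : ν m = 0) : m = 1 := by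
  induction m using hc.induction_left with
  | one => rfl
  | mul f hf m ih =>
    rw [hmul, hcop f hf] at hm
    rw [ih (by omega), hS.eq_one_of_wordLength_eq_zero (g := f) (by omega), hc.one, one_mul]

theorem copy_injOn (hc : IsIntervalPresentation S w c) : Set.InjOn c (leftInterval S w) := by
  obtain ⟨π, hπ⟩ := hc.exists_toGroup
  intro f hf g hg h
  rw [← hπ f hf, h, hπ g hg]

/-- An element of `M` as long as its image in the group, this image being in `[1, w]`, is the copy
of this image. -/
theorem eq_copy (hc : IsIntervalPresentation S w c) (H : IsGarsideInterval S w) {π : M →* G}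
    (hπ : ∀ f ∈ leftInterval S w, π (c f) = f) {ν : M → ℕ} (hone : ν 1 = 0)
    (hmul : ∀ a b, ν (a * b) = ν a + ν b)
    (hcop : ∀ f ∈ leftInterval S w, ν (c f) = wordLength S f) (m : M) :
    wordLength S (π m) ≤ ν m ∧
      (wordLength S (π m) = ν m → π m ∈ leftInterval S w → m = c (π m)) := by
  induction m using hc.induction_left with
  | one => simp [hone, wordLength_one, hc.one]
  | mul f hf m ih =>
    rw [hmul, hcop f hf, map_mul, hπ f hf]
    have h1 := H.wordLength_mul_le f (π m)
    refine ⟨by omega, fun hl hmem => ?_⟩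
    have hred : LeftDivides S f (f * π m) := leftDivides_mul_iff.2 (by omega)
    rw [hc.mul_of_mul_mem H hmem hred,
      ← ih.2 (by omega) (H.right_factor_mem H.balanced hmem hred)]

/-- If `a b = c w`, then `ℓ(w) ≤ ℓ(π a) + ℓ(π b) ≤ ν a + ν b = ℓ(w)`. All are equalities, so
`eq_copy` applies to both factors. -/
theorem divisors_eq (hc : IsIntervalPresentation S w c) (H : IsGarsideInterval S w) :
    {x | IsLeftDivisor x (c w)} = c '' leftInterval S w ∧
      {x | IsRightDivisor x (c w)} = c '' leftInterval S w := by
  obtain ⟨π, hπ⟩ := hc.exists_toGroup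
  obtain ⟨ν, hone, hmul, hcop⟩ := hc.exists_length
  have key : ∀ a b, a * b = c w → a ∈ c '' leftInterval S w ∧ b ∈ c '' leftInterval S w := by
    intro a b hab
    have hw := self_mem_leftInterval S w
    have h1 : π a * π b = w := by rw [← map_mul, hab, hπ w hw]
    have h2 : ν a + ν b = wordLength S w := by rw [← hmul, hab, hcop w hw]
    obtain ⟨ha, ha'⟩ := hc.eq_copy H hπ hone hmul hcop a
    obtain ⟨hb, hb'⟩ := hc.eq_copy H hπ hone hmul hcop b
    have h3 := H.wordLength_mul_le (π a) (π b)
    have h4 : LeftDivides S (π a) (π a * π b) := leftDivides_mul_iff.2 (by rw [h1] at h3 ⊢; omega)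
    have h5 : π b ∈ leftInterval S w := H.right_factor_mem H.balanced (h1 ▸ hw) h4
    have h6 : π a ∈ leftInterval S w := mem_leftInterval.2 (h1 ▸ h4)
    rw [h1] at h3
    exact ⟨⟨π a, h6, (ha' (by omega) h6).symm⟩, ⟨π b, h5, (hb' (by omega) h5).symm⟩⟩
  constructor
  · refine Set.Subset.antisymm (fun x ⟨y, h⟩ => (key x y h).1) ?_
    rintro _ ⟨f, hf, rfl⟩
    exact ⟨_, hc.mul_of_leftDivides H (self_mem_leftInterval S w) (mem_leftInterval.1 hf)⟩
  · refine Set.Subset.antisymm (fun x ⟨y, h⟩ => (key y x h).2) ?_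
    rintro _ ⟨f, hf, rfl⟩
    have hf' : f ∈ rightInterval S w := H.balanced ▸ hf
    obtain ⟨g, hg, hl⟩ := hf'.2
    have hr : LeftDivides S g (g * f) := leftDivides_mul_iff.2 (by rw [← hg, hl])
    refine ⟨c g, ?_⟩
    rw [← hc.mul_of_mul_mem H (hg ▸ self_mem_leftInterval S w) hr, ← hg]

/-- The mirror image of an interval presentation. -/
theorem op (hc : IsIntervalPresentation S w c) (H : IsGarsideInterval S w) :
    IsIntervalPresentation S w⁻¹ (fun g => MulOpposite.op (c g⁻¹)) := by
  have hmem {f : G} : f ∈ leftInterval S w⁻¹ ↔ f⁻¹ ∈ leftInterval S w := by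
    rw [← H.inv_mem_leftInterval_inv H.balanced, inv_inv]
  have hred {f g : G} : LeftDivides S f (f * g) ↔ LeftDivides S g⁻¹ (g⁻¹ * f⁻¹) := by
    rw [leftDivides_mul_iff, leftDivides_mul_iff, ← mul_inv_rev]
    simp only [H.wordLength_inv]
    omega
  refine ⟨by simp [hc.one], fun f hf g hg hfg hl => ?_, ?_, fun {N} _ F h1 hF => ?_⟩
  · rw [hmem, mul_inv_rev] at hfg
    rw [mul_inv_rev, hc.mul_of_mul_mem H hfg (hred.1 hl), MulOpposite.op_mul]
  · rw [eq_top_iff]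
    rintro m -
    induction m using MulOpposite.rec' with
    | h m =>
      induction m using hc.induction_left with
      | one => exact one_mem _
      | mul f hf m ih =>
        rw [MulOpposite.op_mul]
        exact mul_mem ih (Submonoid.subset_closure ⟨f⁻¹, hmem.2 (by simpa using hf), by simp⟩)
  · obtain ⟨φ, hφ⟩ := hc.lift (N := Nᵐᵒᵖ) (fun g => MulOpposite.op (F g⁻¹)) (by simp [h1])
      fun f hf g hg hfg hl => by
        have hi {f : G} (hf : f ∈ leftInterval S w) : f⁻¹ ∈ leftInterval S w⁻¹ :=
          hmem.2 (by simpa using hf)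
        rw [mul_inv_rev, hF _ (hi hg) _ (hi hf) (by simpa using hi hfg)
          (by rw [hred]; simpa using hl), MulOpposite.op_mul]
    refine ⟨⟨⟨fun m => (φ m.unop).unop, by simp⟩, by simp⟩, fun f hf => ?_⟩
    simp [hφ _ (hmem.1 hf)]

/-- Every element factors as its head, the greatest element of `[1, w]` dividing it, and a tail. -/
theorem exists_head_tail (hc : IsIntervalPresentation S w c) (H : IsGarsideInterval S w) :
    ∃ (α : M → G) (ω : M → M), (∀ m, α m ∈ leftInterval S w) ∧ (∀ m, c (α m) * ω m = m) ∧
      ∀ f ∈ leftInterval S w, ∀ m, LeftDivides S f (α (c f * m)) ∧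
        c (f⁻¹ * α (c f * m)) * ω (c f * m) = m := by
  classical
  let P := leftInterval S w
  choose! T hT using fun f (hf : f ∈ P) p (hp : p ∈ P) => H.exists_isTransfer hf hp
  -- `f` absorbs the transfer `T f p` from the head `p`, and the remainder of `p` joins the tail.
  -- The value for `f` outside the interval plays no role.
  let F : G → P × M → P × M := fun f x =>
    if hf : f ∈ P then (⟨f * T f x.1, (hT f hf x.1 x.1.2).mem⟩, c ((T f x.1)⁻¹ * x.1) * x.2) else x
  have hF : ∀ f (hf : f ∈ P) x, F f x =
      (⟨f * T f x.1, (hT f hf x.1 x.1.2).mem⟩, c ((T f x.1)⁻¹ * x.1) * x.2) :=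
    fun f hf x => dif_pos hf
  have hF1 : ∀ x, F 1 x = x := by
    rintro ⟨⟨p, hp⟩, m⟩
    have h1 := one_mem_leftInterval S w
    have h : T 1 p = p := (hT 1 h1 p hp).eq H.toIsSymmGenerating
      ⟨leftDivides_refl p, by simpa using hp, one_leftDivides _, fun h' h _ _ => h⟩
    rw [hF 1 h1]
    simp [h, hc.one]
  -- The defining relations hold for `F`: this is the content of `IsTransfer.of_mul`. The
  -- presentation then extends `F` to an action of `M`.
  have hFmul : ∀ f ∈ P, ∀ g ∈ P, f * g ∈ P → LeftDivides S f (f * g) →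
      ∀ x, F (f * g) x = F f (F g x) := by
    rintro f hf g hg hfg hred ⟨⟨p, hp⟩, m⟩
    have t2 := hT g hg p hp
    have t := hT (f * g) hfg p hp
    obtain ⟨e1, e2⟩ := t.of_mul H hred t2 (hT f hf _ t2.mem)
    rw [hF _ hfg, hF _ hg, hF _ hf]
    refine Prod.ext (Subtype.ext ?_) ?_
    · simp only [e1, mul_assoc]
    · have e3 : LeftDivides S ((T (f * g) p)⁻¹ * T g p) ((T (f * g) p)⁻¹ * p) := by
        refine H.leftDivides_of_mul (z := T (f * g) p) ?_ ?_
        · simpa using e2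
        · simpa using t2.dvd
      have e4 : (T (f * g) p)⁻¹ * p ∈ leftInterval S w :=
        H.right_factor_mem H.balanced (f := T (f * g) p) (by simpa using hp)
          (by simpa using t.dvd)
      have e5 := hc.mul_of_leftDivides H e4 e3
      simp only [mul_inv_rev, inv_inv, mul_assoc, mul_inv_cancel_left] at e5
      simp only [e1, mul_inv_rev, mul_assoc, inv_mul_cancel_left, ← e5]
  obtain ⟨act, hone, hstep⟩ : ∃ act : M → P × M → P × M, (∀ x, act 1 x = x) ∧
      ∀ f ∈ P, ∀ m x, act (c f * m) x = F f (act m x) := by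
    obtain ⟨φ, hφ⟩ := hc.lift (N := Function.End (P × M)) F (funext hF1)
      fun f hf g hg hfg hred => funext (hFmul f hf g hg hfg hred)
    refine ⟨φ, fun x => by rw [map_one]; rfl, fun f hf m x => ?_⟩
    rw [map_mul, hφ f hf]
    rfl
  let x₀ : P × M := (⟨1, one_mem_leftInterval S w⟩, 1)
  have hdec : ∀ m, c (act m x₀).1 * (act m x₀).2 = m := by
    intro m
    induction m using hc.induction_left with
    | one => simp [x₀, hc.one, hone]
    | mul f hf m ih =>
      have t := hT f hf _ (act m x₀).1.2
      rw [hstep f hf, hF f hf]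
      dsimp only
      rw [hc.mul_of_mul_mem H t.mem t.reduced, mul_assoc, ← mul_assoc (c (T _ _)),
        hc.mul_of_leftDivides H (act m x₀).1.2 t.dvd, ih]
  refine ⟨fun m => (act m x₀).1, fun m => (act m x₀).2, fun m => (act m x₀).1.2, hdec,
    fun f hf m => ?_⟩
  have t := hT f hf _ (act m x₀).1.2
  simp only [hstep f hf, hF f hf]
  refine ⟨t.reduced, ?_⟩
  -- What `f` absorbed, times what it pushed away, is the old head; so the old head and tail are
  -- restored, and their product is `m`.
  rw [inv_mul_cancel_left, ← mul_assoc, hc.mul_of_leftDivides H (act m x₀).1.2 t.dvd, hdec]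

/-- The head and tail of `c f * m`, together with `f`, determine `m`. -/
theorem left_cancel (hc : IsIntervalPresentation S w c) (H : IsGarsideInterval S w) (a m m' : M)
    (h : a * m = a * m') : m = m' := by
  obtain ⟨α, ω, -, -, hα⟩ := hc.exists_head_tail H
  induction a using hc.induction_left with
  | one => simpa using h
  | mul f hf a ih =>
    rw [mul_assoc, mul_assoc] at h
    exact ih (by rw [← (hα f hf (a * m)).2, h, (hα f hf (a * m')).2])

/-- The head of a common multiple is divisible by both `f` and `g`, hence by their join in the
interval. -/
theorem exists_lcm_copy (hc : IsIntervalPresentation S w c) (H : IsGarsideInterval S w) {f g : G}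
    (hf : f ∈ leftInterval S w) (hg : g ∈ leftInterval S w) :
    ∃ h ∈ leftInterval S w, ∃ k ∈ leftInterval S w, c f * c h = c g * c k ∧
      ∀ m, IsLeftDivisor (c f) m → IsLeftDivisor (c g) m → IsLeftDivisor (c f * c h) m := by
  obtain ⟨α, ω, hmem, hαω, hα⟩ := hc.exists_head_tail H
  obtain ⟨j, hj, hfj, hgj, hmin⟩ := H.lattice.exists_join f hf g hg
  have hfac {f : G} (h : LeftDivides S f j) : f⁻¹ * j ∈ leftInterval S w :=
    H.right_factor_mem H.balanced (f := f) (by simpa using hj) (by simpa using h)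
  refine ⟨f⁻¹ * j, hfac hfj, g⁻¹ * j, hfac hgj, ?_, ?_⟩
  · rw [hc.mul_of_leftDivides H hj hfj, hc.mul_of_leftDivides H hj hgj]
  · rintro _ ⟨m, rfl⟩ ⟨m', hm'⟩
    rw [hc.mul_of_leftDivides H hj hfj]
    have h1 := hmin _ (hmem (c f * m)) (hα f hf m).1 (hm' ▸ (hα g hg m').1)
    refine ⟨c (j⁻¹ * α (c f * m)) * ω (c f * m), ?_⟩
    rw [← mul_assoc, hc.mul_of_leftDivides H (hmem _) h1, hαω]

/-- Right multiples `a u = b v` such that `a u` is the least common multiple of `a` and `b`. -/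
theorem exists_lcm_left (hc : IsIntervalPresentation S w c) (H : IsGarsideInterval S w)
    (a b : M) : ∃ u v, a * u = b * v ∧
      ∀ m, IsLeftDivisor a m → IsLeftDivisor b m → IsLeftDivisor (a * u) m := by
  -- Tiling of lcm squares. The complement `k` of `f` along `g` is again in the interval, so the
  -- induction on `b` can run over all `f` there; left cancellation carries minimality from one tile
  -- to the next.
  have step : ∀ f ∈ leftInterval S w, ∀ b, ∃ u v, c f * u = b * v ∧
      ∀ m, IsLeftDivisor (c f) m → IsLeftDivisor b m → IsLeftDivisor (c f * u) m := by
    intro f hf b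
    induction b using hc.induction_left generalizing f with
    | one => exact ⟨1, c f, by simp, fun m h _ => by simpa using h⟩
    | mul g hg b ih =>
      obtain ⟨h, hh, k, hk, e1, hmin⟩ := hc.exists_lcm_copy H hf hg
      obtain ⟨u, v, e2, hmin'⟩ := ih k hk
      refine ⟨c h * u, v, by rw [← mul_assoc, e1, mul_assoc, e2, mul_assoc], ?_⟩
      rintro m hfm ⟨m', rfl⟩
      rw [mul_assoc] at hfm ⊢
      obtain ⟨x, hx⟩ := hmin _ hfm ⟨b * m', rfl⟩
      rw [e1, mul_assoc] at hx
      obtain ⟨y, hy⟩ := hmin' (b * m') ⟨x, hc.left_cancel H _ _ _ hx⟩ ⟨m', rfl⟩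
      exact ⟨y, by rw [← hy, ← mul_assoc, e1, mul_assoc, mul_assoc, mul_assoc]⟩
  induction a using hc.induction_left generalizing b with
  | one => exact ⟨b, 1, by simp, fun m _ h => by simpa using h⟩
  | mul f hf a ih =>
    obtain ⟨u, v, e1, hmin⟩ := step f hf b
    obtain ⟨x, y, e2, hmin'⟩ := ih u
    refine ⟨x, v * y, by rw [mul_assoc, e2, ← mul_assoc, e1, mul_assoc], ?_⟩
    rintro _ ⟨m, rfl⟩ hb
    rw [mul_assoc] at hb ⊢
    obtain ⟨z, hz⟩ := hmin _ ⟨a * m, rfl⟩ hb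
    rw [mul_assoc] at hz
    obtain ⟨t, ht⟩ := hmin' (a * m) ⟨m, rfl⟩ ⟨z, hc.left_cancel H _ _ _ hz⟩
    exact ⟨t, by rw [mul_assoc] at ht; simp only [mul_assoc, ht]⟩

theorem exists_join_left (hc : IsIntervalPresentation S w c) (H : IsGarsideInterval S w)
    (a b : M) : ∃ m, IsJoinOn IsLeftDivisor Set.univ a b m := by
  obtain ⟨u, v, e, hmin⟩ := hc.exists_lcm_left H a b
  exact ⟨a * u, trivial, ⟨u, rfl⟩, ⟨v, e.symm⟩, fun m _ => hmin m⟩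

theorem exists_meet_left (hc : IsIntervalPresentation S w c) (H : IsGarsideInterval S w)
    (a b : M) : ∃ m, IsMeetOn IsLeftDivisor Set.univ a b m := by
  obtain ⟨ν, hone, hmul, hcop⟩ := hc.exists_length
  let T : Set ℕ := {k | ∃ d, IsLeftDivisor d a ∧ IsLeftDivisor d b ∧ ν d = k}
  have hT : BddAbove T := ⟨ν a, by rintro _ ⟨d, ⟨x, rfl⟩, -, rfl⟩; simp [hmul]⟩
  obtain ⟨d, hda, hdb, hd⟩ :=
    Nat.sSup_mem (s := T) ⟨ν 1, 1, ⟨a, by simp⟩, ⟨b, by simp⟩, rfl⟩ hT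
  refine ⟨d, trivial, hda, hdb, fun x _ hxa hxb => ?_⟩
  obtain ⟨u, v, e, hmin⟩ := hc.exists_lcm_left H d x
  have hle : ν (d * u) ≤ ν d := hd ▸ le_csSup hT ⟨_, hmin a hda hxa, hmin b hdb hxb, rfl⟩
  rw [hmul] at hle
  have hu : u = 1 := hc.eq_one_of_length_eq_zero H.toIsSymmGenerating hmul hcop u (by omega)
  exact ⟨v, by rw [← e, hu, mul_one]⟩

theorem isGarsideElement (hc : IsIntervalPresentation S w c) (H : IsGarsideInterval S w)
    (hfin : (leftInterval S w).Finite) : IsGarsideElement (c w) := by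
  obtain ⟨h1, h2⟩ := hc.divisors_eq H
  exact ⟨h1.trans h2.symm, h1 ▸ hc.generates, h1 ▸ hfin.image c⟩

theorem _root_.isLeftDivisor_op {M : Type*} [Monoid M] {a b : M} :
    IsLeftDivisor (MulOpposite.op a) (MulOpposite.op b) ↔ IsRightDivisor a b :=
  ⟨fun ⟨x, hx⟩ => ⟨x.unop, MulOpposite.op_injective hx⟩,
    fun ⟨x, hx⟩ => ⟨MulOpposite.op x, MulOpposite.unop_injective hx⟩⟩

/-- Each right-hand clause is the left-hand one for the opposite monoid, through `op` and the
hypotheses on `w⁻¹`. -/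
theorem isGarsideMonoid (hc : IsIntervalPresentation S w c) (H : IsGarsideInterval S w)
    (hfin : (leftInterval S w).Finite) : IsGarsideMonoid M where
  left_cancel := hc.left_cancel H
  right_cancel f g h hfg := MulOpposite.op_injective
    ((hc.op H).left_cancel H.inv (.op f) _ _ (MulOpposite.unop_injective hfg))
  exists_norm := by
    obtain ⟨ν, -, hmul, hcop⟩ := hc.exists_length
    exact ⟨ν, fun f g => (hmul f g).ge, fun g hg h =>
      hg (hc.eq_one_of_length_eq_zero H.toIsSymmGenerating hmul hcop g h)⟩
  exists_left_gcd := hc.exists_meet_left H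
  exists_left_lcm := hc.exists_join_left H
  exists_right_gcd a b := by
    obtain ⟨m, -, h1, h2, h3⟩ := (hc.op H).exists_meet_left H.inv (.op a) (.op b)
    exact ⟨m.unop, trivial, isLeftDivisor_op.1 h1, isLeftDivisor_op.1 h2, fun x _ hxa hxb =>
      isLeftDivisor_op.1 (h3 (.op x) trivial (isLeftDivisor_op.2 hxa) (isLeftDivisor_op.2 hxb))⟩
  exists_right_lcm a b := by
    obtain ⟨m, -, h1, h2, h3⟩ := (hc.op H).exists_join_left H.inv (.op a) (.op b)
    exact ⟨m.unop, trivial, isLeftDivisor_op.1 h1, isLeftDivisor_op.1 h2, fun x _ hxa hxb =>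
      isLeftDivisor_op.1 (h3 (.op x) trivial (isLeftDivisor_op.2 hxa) (isLeftDivisor_op.2 hxb))⟩
  exists_garside := ⟨c w, hc.isGarsideElement H hfin⟩

end IsIntervalPresentation

end IntervalPresentation

/-! ### Group of fractions by Ore localization -/

section Fractions

open OreLocalization in
theorem IsGarsideMonoid.exists_isGroupOfFractions {M : Type} [Monoid M] (hM : IsGarsideMonoid M) :
    ∃ (Γ : Type) (_ : Group Γ) (ι : M →* Γ), IsGroupOfFractions ι := by
  have hore : ∀ a b : M, ∃ x y, y * a = x * b := fun a b => by
    obtain ⟨m, -, ⟨y, hy⟩, ⟨x, hx⟩, -⟩ := hM.exists_right_lcm a b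
    exact ⟨x, y, hy.trans hx.symm⟩
  choose num den hnd using hore
  let : OreSet (⊤ : Submonoid M) :=
    { ore_right_cancel := fun a b s h => ⟨1, by rw [hM.right_cancel _ _ _ h]⟩
      oreNum := fun r s => num r s
      oreDenom := fun r s => ⟨den r s, trivial⟩
      ore_eq := fun r s => hnd r s }
  let Q := OreLocalization (⊤ : Submonoid M) M
  let ι : M →* Q := numeratorHom
  have hfrac : ∀ q : Q, ∃ a b : M, ι a * q = ι b := by
    intro q
    induction q using OreLocalization.ind with
    | c r s => exact ⟨s, r, OreLocalization.mul_cancel⟩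
  have hunit : ∀ a, IsUnit (ι a) := fun a => numerator_isUnit (⟨a, trivial⟩ : (⊤ : Submonoid M))
  -- Every element of `M` is allowed as a denominator, so each fraction is a quotient of two units.
  let : Group Q := groupOfIsUnit fun q => by
    obtain ⟨a, b, h⟩ := hfrac q
    obtain ⟨u, hu⟩ := hunit a
    rw [← hu, ← Units.eq_inv_mul_iff_mul_eq] at h
    exact h ▸ u⁻¹.isUnit.mul (hunit b)
  have hleft : ∀ q : Q, ∃ a b : M, q = (ι a)⁻¹ * ι b := fun q => by
    obtain ⟨a, b, h⟩ := hfrac q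
    exact ⟨a, b, by rw [← h, inv_mul_cancel_left]⟩
  refine ⟨Q, inferInstance, ι, fun a b hab => ?_, fun q => ?_, hleft⟩
  · obtain ⟨u, v, h1, h2⟩ := oreDiv_eq_iff.1 hab
    have h2' : (u : M) = v := by simpa using h2
    have h1' : (u : M) * b = v * a := h1
    exact (hM.left_cancel _ _ _ (h2' ▸ h1')).symm
  · obtain ⟨a, b, rfl⟩ := hleft q
    -- A common multiple `a x = b y` rewrites `a⁻¹ b` as `x y⁻¹`.
    obtain ⟨m, -, ⟨x, hx⟩, ⟨y, hy⟩, -⟩ := hM.exists_left_lcm a b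
    refine ⟨x, y, ?_⟩
    rw [eq_mul_inv_iff_mul_eq, mul_assoc, ← map_mul, hy, ← hx, map_mul, inv_mul_cancel_left]

end Fractions

/-! ### The presented monoid satisfies the abstract presentation -/

section IntervalMonoid

open Classical in
/-- The copy in the interval monoid, extended by `1` outside of the interval. -/
noncomputable def IntervalMonoid.copyExt {G : Type*} [Group G] (S : Set G) (w : G) (f : G) :
    IntervalMonoid S w :=
  if hf : f ∈ leftInterval S w then IntervalMonoid.copy S w ⟨f, hf⟩ else 1

theorem IntervalMonoid.copyExt_eq {G : Type*} [Group G] {S : Set G} {w f : G}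
    (hf : f ∈ leftInterval S w) : copyExt S w f = copy S w ⟨f, hf⟩ := dif_pos hf

theorem IntervalMonoid.isIntervalPresentation {G : Type} [Group G] (S : Set G) (w : G) :
    IsIntervalPresentation S w (copyExt S w) where
  one := by
    rw [copyExt_eq (one_mem_leftInterval S w)]
    exact Quot.sound (ConGen.Rel.of _ _ IntervalRel.one)
  mul f hf g hg hfg hl := by
    rw [copyExt_eq hf, copyExt_eq hg, copyExt_eq hfg]
    exact (Quot.sound (ConGen.Rel.of _ _
      (IntervalRel.mul ⟨f, hf⟩ ⟨g, hg⟩ ⟨_, hfg⟩ rfl (leftDivides_mul_iff.1 hl).symm))).symm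
  generates := by
    rw [eq_top_iff, ← PresentedMonoid.closure_range_of]
    refine Submonoid.closure_mono ?_
    rintro _ ⟨⟨f, hf⟩, rfl⟩
    exact ⟨f, hf, copyExt_eq hf⟩
  lift F h1 hF := by
    refine ⟨PresentedMonoid.lift (fun f : leftInterval S w => F f) ?_, fun f hf => by rw [copyExt_eq hf]; rfl⟩
    intro a b hab
    cases hab with
    | one => simpa using h1
    | mul f g h hmul hlen =>
      simp only [map_mul, FreeMonoid.lift_eval_of]
      rw [← hmul, hF f f.2 g g.2 (hmul ▸ h.2)]
      rw [leftDivides_mul_iff, hmul, hlen]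

end IntervalMonoid

/-! ### Permutation and entries of a monomial matrix -/

namespace Geen

variable {e n : ℕ}

theorem exists_toMatrix_eq (w : Geen e n) : ∃ (σ : Equiv.Perm (Fin n)) (a : Fin n → ℂ),
    (∀ i, a i ≠ 0) ∧ (∀ i, a i ^ e = 1) ∧ ∏ i, a i = 1 ∧ toMatrix w = monomialMatrix σ a := w.2

/-- The permutation underlying an element of `G(e,e,n)`: the nonzero entry of row `r` is in
column `perm w r`. -/
noncomputable def perm (w : Geen e n) : Equiv.Perm (Fin n) := (exists_toMatrix_eq w).choose

/-- The nonzero entry of each row. -/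
noncomputable def coef (w : Geen e n) : Fin n → ℂ := (exists_toMatrix_eq w).choose_spec.choose

theorem coef_ne_zero (w : Geen e n) (r : Fin n) : coef w r ≠ 0 :=
  (exists_toMatrix_eq w).choose_spec.choose_spec.1 r

theorem coef_pow (w : Geen e n) (r : Fin n) : coef w r ^ e = 1 :=
  (exists_toMatrix_eq w).choose_spec.choose_spec.2.1 r

theorem prod_coef (w : Geen e n) : ∏ r, coef w r = 1 :=
  (exists_toMatrix_eq w).choose_spec.choose_spec.2.2.1

theorem toMatrix_eq (w : Geen e n) : toMatrix w = monomialMatrix (perm w) (coef w) :=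
  (exists_toMatrix_eq w).choose_spec.choose_spec.2.2.2

theorem toMatrix_apply (w : Geen e n) (r c : Fin n) :
    toMatrix w r c = if c = perm w r then coef w r else 0 := by
  rw [toMatrix_eq]; rfl

theorem toMatrix_ne_zero_iff (w : Geen e n) (r c : Fin n) :
    toMatrix w r c ≠ 0 ↔ c = perm w r := by
  rw [toMatrix_apply]
  split_ifs with h <;> simp [h, coef_ne_zero]

theorem toMatrix_perm (w : Geen e n) (r : Fin n) : toMatrix w r (perm w r) = coef w r := by
  simp [toMatrix_apply]

theorem perm_coef_of_eq {w : Geen e n} {σ : Equiv.Perm (Fin n)} {a : Fin n → ℂ}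
    (h : toMatrix w = monomialMatrix σ a) : perm w = σ ∧ coef w = a := by
  have h1 : ∀ r, perm w r = σ r := fun r => by
    have h2 := toMatrix_perm w r
    rw [h] at h2
    by_contra h3
    exact coef_ne_zero w r (by rw [← h2]; simp [monomialMatrix, h3])
  refine ⟨Equiv.ext h1, funext fun r => ?_⟩
  rw [← toMatrix_perm, h, h1]
  simp [monomialMatrix]

theorem ext_perm_coef {v w : Geen e n} (hp : perm v = perm w) (hc : coef v = coef w) : v = w := by
  have h : toMatrix v = toMatrix w := by rw [toMatrix_eq, toMatrix_eq, hp, hc]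
  exact Subtype.ext (Units.ext h)

theorem perm_coef_ofExponents (σ : Equiv.Perm (Fin n)) (m : Fin n → ℤ) (hm : ∑ i, m i = 0) :
    perm (ofExponents e σ m hm) = σ ∧ coef (ofExponents e σ m hm) = fun r => zeta e ^ m r :=
  perm_coef_of_eq rfl

@[simp]
theorem perm_one : perm (1 : Geen e n) = 1 :=
  (perm_coef_of_eq (w := 1) monomialMatrix_one.symm).1

@[simp]
theorem coef_one : coef (1 : Geen e n) = fun _ => 1 :=
  (perm_coef_of_eq (w := 1) monomialMatrix_one.symm).2

/-- Row `r` meets column `perm v r` of `v` and continues in that row of `w`, so the permutations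
compose in reverse order. -/
theorem perm_coef_mul (v w : Geen e n) :
    perm (v * w) = perm w * perm v ∧ coef (v * w) = fun r => coef v r * coef w (perm v r) := by
  refine perm_coef_of_eq ?_
  rw [← monomialMatrix_mul, ← toMatrix_eq, ← toMatrix_eq]
  rfl

theorem perm_inv (w : Geen e n) : perm w⁻¹ = (perm w)⁻¹ := by
  have h := (perm_coef_mul w w⁻¹).1
  rw [mul_inv_cancel, perm_one] at h
  exact eq_inv_of_mul_eq_one_left h.symm

theorem coef_inv (w : Geen e n) (r : Fin n) : coef w⁻¹ (perm w r) = (coef w r)⁻¹ := by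
  have h := congrFun (perm_coef_mul w w⁻¹).2 r
  rw [mul_inv_cancel, coef_one] at h
  exact eq_inv_of_mul_eq_one_right h.symm

theorem perm_inv_mul (v w : Geen e n) (r : Fin n) : perm (v⁻¹ * w) (perm v r) = perm w r := by
  rw [(perm_coef_mul _ _).1, perm_inv]
  simp

theorem coef_inv_mul (v w : Geen e n) (r : Fin n) :
    coef (v⁻¹ * w) (perm v r) = (coef v r)⁻¹ * coef w r := by
  simp [(perm_coef_mul _ _).2, coef_inv, perm_inv]

/-! ### The length function -/

open Classical in
/-- The contribution of the rows `r` and `s` to the distance from `v` to `w`. -/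
noncomputable def pairDist (v w : Geen e n) (r s : Fin n) : ℕ :=
  if perm v r < perm v s then
    if perm w s < perm w r then 1 else if coef v s = coef w s then 0 else 2
  else if perm w r < perm w s then 1 else if coef v r = coef w r then 0 else 2

/-- The contribution of the rows `r` and `s` to left divisibility of `w` by `v`. -/
structure PairDivides (v w : Geen e n) (r s : Fin n) : Prop where
  lt_lt : perm v r < perm v s → perm w r < perm w s → coef v s = 1 ∨ coef v s = coef w s
  lt_gt : perm v r < perm v s → perm w s < perm w r → coef v s = 1
  gt_lt : perm v s < perm v r → perm w r < perm w s → coef w s ≠ 1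
  gt_gt : perm v s < perm v r → perm w s < perm w r → coef v r = coef w r

/-- The length, as a sum over the pairs of rows. -/
noncomputable def len (w : Geen e n) : ℕ := ∑ r, ∑ s, if r < s then pairDist 1 w r s else 0

theorem sum_sum_eq_sum_lt {ι : Type*} [Fintype ι] [LinearOrder ι] (g : ι → ι → ℕ)
    (hg : ∀ r, g r r = 0) :
    ∑ r, ∑ s, g r s = ∑ r, ∑ s, if r < s then g r s + g s r else 0 := by
  have h1 : ∀ r s, g r s = (if r < s then g r s else 0) + if s < r then g r s else 0 := by
    intro r s
    rcases lt_trichotomy r s with h | rfl | h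
    · simp [h, h.not_gt]
    · simp [hg]
    · simp [h, h.not_gt]
  have h2 : ∀ r s, (if r < s then g r s + g s r else 0) =
      (if r < s then g r s else 0) + if r < s then g s r else 0 := by
    intro r s
    split_ifs <;> rfl
  simp_rw [h2, Finset.sum_add_distrib]
  rw [Finset.sum_comm (f := fun r s => if r < s then g s r else 0), ← Finset.sum_add_distrib]
  refine Finset.sum_congr rfl fun r _ => ?_
  rw [← Finset.sum_add_distrib]
  exact Finset.sum_congr rfl fun s _ => h1 r s

/-- Relabelling rows by `perm v` makes `s` or `r` the later row according to the order of their
images, whence the two branches of `pairDist`. The entry of `v⁻¹ * w` in row `perm v t` is 1 exactly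
when `v` and `w` agree in row `t`. -/
theorem len_inv_mul (v w : Geen e n) :
    len (v⁻¹ * w) = ∑ r, ∑ s, if r < s then pairDist v w r s else 0 := by
  have key : len (v⁻¹ * w) = ∑ r, ∑ s, if perm v r < perm v s then
      pairDist 1 (v⁻¹ * w) (perm v r) (perm v s) else 0 :=
    (Equiv.sum_comp (perm v) _).symm.trans
      (Finset.sum_congr rfl fun r _ => (Equiv.sum_comp (perm v) _).symm)
  rw [key, sum_sum_eq_sum_lt _ (by simp)]
  refine Finset.sum_congr rfl fun r _ => Finset.sum_congr rfl fun s _ => ?_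
  by_cases hrs : r < s
  · rw [if_pos hrs, if_pos hrs]
    have hne : perm v r ≠ perm v s := (perm v).injective.ne hrs.ne
    have hc : ∀ t, (1 = coef (v⁻¹ * w) (perm v t)) = (coef v t = coef w t) := fun t => by
      rw [coef_inv_mul, eq_inv_mul_iff_mul_eq₀ (coef_ne_zero v t), mul_one]
    rcases hne.lt_or_gt with h | h <;>
      simp [pairDist, h, h.not_gt, perm_inv_mul, hc]
  · rw [if_neg hrs, if_neg hrs]

/-- If neither `v` nor `w` inverts the pair, this is twice the discrete metric on `1`, `coef v s`,
`coef w s`, with equality when the middle point is one of the ends. If `w` alone inverts, it reads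
`1 ≤ (0 or 2) + 1`; if `v` alone, `(0 or 2) ≤ 1 + 1`; if both, `1 ≤ 1 + (0 or 2)`. -/
theorem pairDist_one_le (v w : Geen e n) {r s : Fin n} (hrs : r < s) :
    pairDist 1 w r s ≤ pairDist 1 v r s + pairDist v w r s ∧
      (pairDist 1 w r s = pairDist 1 v r s + pairDist v w r s ↔ PairDivides v w r s) := by
  have hv : perm v r ≠ perm v s := (perm v).injective.ne hrs.ne
  have hw : perm w r ≠ perm w s := (perm w).injective.ne hrs.ne
  have hP : PairDivides v w r s ↔
      (perm v r < perm v s → perm w r < perm w s → coef v s = 1 ∨ coef v s = coef w s) ∧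
      (perm v r < perm v s → perm w s < perm w r → coef v s = 1) ∧
      (perm v s < perm v r → perm w r < perm w s → coef w s ≠ 1) ∧
      (perm v s < perm v r → perm w s < perm w r → coef v r = coef w r) :=
    ⟨fun ⟨h1, h2, h3, h4⟩ => ⟨h1, h2, h3, h4⟩, fun ⟨h1, h2, h3, h4⟩ => ⟨h1, h2, h3, h4⟩⟩
  rw [hP]
  have h1 : ∀ u : Geen e n, pairDist 1 u r s =
      if perm u s < perm u r then 1 else if 1 = coef u s then 0 else 2 := fun u => by
    simp [pairDist, hrs]
  rw [h1, h1]
  rcases hv.lt_or_gt with h | h <;> rcases hw.lt_or_gt with h' | h' <;>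
    simp only [pairDist, h, h', h.not_gt, h'.not_gt, if_true, if_false, true_imp_iff,
      false_imp_iff, and_true, true_and]
  · by_cases h2 : 1 = coef v s <;> by_cases h3 : coef v s = coef w s
    · simp [← h3, ← h2]
    · have h4 : (1 : ℂ) ≠ coef w s := fun h => h3 (h2.symm.trans h)
      simp [← h2, h4]
    · have h4 : (1 : ℂ) ≠ coef w s := fun h => h2 (h.trans h3.symm)
      simp [h3, h4]
    · by_cases h4 : 1 = coef w s
      · simp [h3, h4]
      · simp [h3, h4]
        exact eq_comm
  · by_cases h2 : 1 = coef v s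
    · simp [← h2]
    · simp [h2, Ne.symm h2]
  · by_cases h2 : 1 = coef w s
    · simp [← h2]
    · simp [h2, Ne.symm h2]
  · by_cases h2 : coef v r = coef w r <;> simp [h2]

theorem len_le (v w : Geen e n) : len w ≤ len v + len (v⁻¹ * w) := by
  rw [len_inv_mul, len, len, ← Finset.sum_add_distrib]
  refine Finset.sum_le_sum fun r _ => ?_
  rw [← Finset.sum_add_distrib]
  refine Finset.sum_le_sum fun s _ => ?_
  split_ifs with h
  · exact (pairDist_one_le v w h).1
  · simp

theorem len_eq_iff (v w : Geen e n) :
    len w = len v + len (v⁻¹ * w) ↔ ∀ r s, r < s → PairDivides v w r s := by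
  have hle : ∀ r s : Fin n, (if r < s then pairDist 1 w r s else 0) ≤
      (if r < s then pairDist 1 v r s else 0) + if r < s then pairDist v w r s else 0 := by
    intro r s
    split_ifs with h
    · exact (pairDist_one_le v w h).1
    · simp
  rw [len_inv_mul, len, len, ← Finset.sum_add_distrib]
  simp_rw [← Finset.sum_add_distrib]
  rw [Finset.sum_eq_sum_iff_of_le fun r _ => Finset.sum_le_sum fun s _ => hle r s]
  simp only [Finset.mem_univ, true_imp_iff]
  refine forall_congr' fun r => ?_
  rw [Finset.sum_eq_sum_iff_of_le fun s _ => hle r s]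
  simp only [Finset.mem_univ, true_imp_iff]
  refine forall_congr' fun s => ?_
  split_ifs with h
  · simp [(pairDist_one_le v w h).2, h]
  · simp [h]

end Geen

namespace Geen

variable {e n : ℕ}

/-! ### The generators -/

/-- `x` exchanges the consecutive rows `p` and `p₁`, with entries `z` and `z⁻¹` there; unless
these are the first two rows, `z = 1`. -/
structure IsAtom (x : Geen e n) (p p₁ : Fin n) (z : ℂ) : Prop where
  perm_eq : perm x = Equiv.swap p p₁
  val_eq : p₁.val = p.val + 1
  coef_fst : coef x p = z
  coef_snd : coef x p₁ = z⁻¹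
  coef_of_ne : ∀ r, r ≠ p → r ≠ p₁ → coef x r = 1
  eq_one_or : z = 1 ∨ p.val = 0

theorem isAtom_t (hn : 2 ≤ n) (i : ℕ) :
    IsAtom (t e hn i) ⟨0, by omega⟩ ⟨1, by omega⟩ (zeta e ^ (-(i : ℤ))) := by
  obtain ⟨h1, h2⟩ := perm_coef_ofExponents (e := e) (Equiv.swap (⟨0, by omega⟩ : Fin n) ⟨1, by omega⟩)
    (fun r => if r.val = 0 then -(i : ℤ) else if r.val = 1 then (i : ℤ) else 0) (by
      obtain ⟨p, rfl⟩ := Nat.exists_eq_add_of_le' hn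
      simp [Fin.sum_univ_succ])
  refine ⟨h1, rfl, by rw [t, h2]; simp, by rw [t, h2]; simp, fun r hr hr' => ?_, Or.inr rfl⟩
  rw [Ne, Fin.ext_iff] at hr hr'
  rw [t, h2]
  simp_all

theorem isAtom_s (j : ℕ) (h3 : 3 ≤ j) (hjn : j ≤ n) :
    IsAtom (s e j h3 hjn) ⟨j - 2, by omega⟩ ⟨j - 1, by omega⟩ 1 := by
  obtain ⟨h1, h2⟩ := perm_coef_ofExponents (e := e)
    (Equiv.swap (⟨j - 2, by omega⟩ : Fin n) ⟨j - 1, by omega⟩) (fun _ => 0) (by simp)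
  have hc : ∀ r, coef (s e j h3 hjn) r = 1 := fun r => by rw [s, h2]; simp
  exact ⟨h1, show j - 1 = j - 2 + 1 by omega, hc _, by simp [hc], fun r _ _ => hc r, Or.inl rfl⟩

theorem exists_isAtom_of_mem {x : Geen e n} (hx : x ∈ X e n) :
    ∃ p p₁ z, IsAtom x p p₁ z := by
  rcases hx with ⟨hn, i, -, rfl⟩ | ⟨j, h3, hjn, rfl⟩
  · exact ⟨_, _, _, isAtom_t hn i⟩
  · exact ⟨_, _, _, isAtom_s j h3 hjn⟩

theorem exists_mem_isAtom (he : 0 < e) {p p₁ : Fin n} (hp : p₁.val = p.val + 1) {z : ℂ}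
    (hz : z ^ e = 1) (hzp : z = 1 ∨ p.val = 0) : ∃ x ∈ X e n, IsAtom x p p₁ z := by
  have hn : 2 ≤ n := by have := p₁.isLt; omega
  by_cases h0 : p.val = 0
  · have := NeZero.of_pos he
    obtain ⟨i, hi, hiz⟩ := (Complex.isPrimitiveRoot_exp e he.ne').eq_pow_of_pow_eq_one
      (show z⁻¹ ^ e = 1 by rw [inv_pow, hz, inv_one])
    refine ⟨t e hn i, Or.inl ⟨hn, i, hi, rfl⟩, ?_⟩
    have h := isAtom_t (e := e) hn i
    have e1 : zeta e ^ (-(i : ℤ)) = z := by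
      rw [zpow_neg, zpow_natCast, zeta, hiz, inv_inv]
    have e2 : (⟨0, by omega⟩ : Fin n) = p := Fin.ext h0.symm
    have e3 : (⟨1, by omega⟩ : Fin n) = p₁ := Fin.ext (by rw [hp, h0])
    rwa [e1, e2, e3] at h
  · obtain rfl : z = 1 := hzp.resolve_right h0
    have hjn : p.val + 2 ≤ n := by have := p₁.isLt; omega
    have h3 : 3 ≤ p.val + 2 := by omega
    refine ⟨s e (p.val + 2) h3 hjn, Or.inr ⟨_, h3, hjn, rfl⟩, ?_⟩
    have h := isAtom_s (e := e) (p.val + 2) h3 hjn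
    have e2 : (⟨p.val + 2 - 2, by omega⟩ : Fin n) = p := Fin.ext (by simp)
    have e3 : (⟨p.val + 2 - 1, by omega⟩ : Fin n) = p₁ := Fin.ext (by simp [hp])
    rwa [e2, e3] at h

theorem swap_lt_swap {p p₁ r s : Fin n} (hp : p₁.val = p.val + 1) (hrs : r < s) :
    (r = p ∧ s = p₁) ∨ Equiv.swap p p₁ r < Equiv.swap p p₁ s := by
  simp only [Equiv.swap_apply_def]
  split_ifs <;> simp only [Fin.ext_iff, Fin.lt_def] at * <;> omega

theorem pairDivides_of_lt {v w : Geen e n} {r s : Fin n} (h : perm v r < perm v s)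
    (hc : coef v s = 1) : PairDivides v w r s :=
  ⟨fun _ _ => Or.inl hc, fun _ _ => hc, fun h' => absurd h' h.not_gt, fun h' => absurd h' h.not_gt⟩

theorem pairDivides_of_gt {v w : Geen e n} {r s : Fin n} (h : perm v s < perm v r)
    (h1 : perm w r < perm w s → coef w s ≠ 1) (h2 : perm w s < perm w r → coef v r = coef w r) :
    PairDivides v w r s :=
  ⟨fun h' => absurd h' h.not_gt, fun h' => absurd h' h.not_gt, fun _ => h1, fun _ => h2⟩

theorem IsAtom.perm_fst {x : Geen e n} {p p₁ : Fin n} {z : ℂ} (hx : IsAtom x p p₁ z) :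
    perm x p = p₁ := by simp [hx.perm_eq]

theorem IsAtom.perm_snd {x : Geen e n} {p p₁ : Fin n} {z : ℂ} (hx : IsAtom x p p₁ z) :
    perm x p₁ = p := by simp [hx.perm_eq]

theorem IsAtom.lt {x : Geen e n} {p p₁ : Fin n} {z : ℂ} (hx : IsAtom x p p₁ z) : p < p₁ := by
  rw [Fin.lt_def, hx.val_eq]; omega

/-- A nontrivial entry can occur only in the first two rows, and the second row is the later one
only in the pair `(p, p₁)`. -/
theorem IsAtom.perm_lt_or {x : Geen e n} {p p₁ : Fin n} {z : ℂ} (hx : IsAtom x p p₁ z)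
    {r s : Fin n} (hrs : r < s) :
    (r = p ∧ s = p₁) ∨ (perm x r < perm x s ∧ coef x s = 1) := by
  rcases swap_lt_swap hx.val_eq hrs with h | h
  · exact Or.inl h
  by_cases h' : r = p ∧ s = p₁
  · exact Or.inl h'
  refine Or.inr ⟨by rwa [hx.perm_eq], ?_⟩
  rcases hx.eq_one_or with rfl | h0
  · by_cases h1 : s = p
    · rw [h1, hx.coef_fst]
    by_cases h2 : s = p₁
    · rw [h2, hx.coef_snd, inv_one]
    exact hx.coef_of_ne s h1 h2
  · have hv := hx.val_eq
    rw [Fin.lt_def] at hrs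
    refine hx.coef_of_ne s (fun h => ?_) fun h => h' ⟨Fin.ext ?_, h⟩ <;> rw [h] at hrs <;> omega

theorem IsAtom.pairDivides_iff {x : Geen e n} {p p₁ : Fin n} {z : ℂ} (hx : IsAtom x p p₁ z)
    (w : Geen e n) : (∀ r s, r < s → PairDivides x w r s) ↔
      (perm w p < perm w p₁ → coef w p₁ ≠ 1) ∧ (perm w p₁ < perm w p → coef w p = z) := by
  have hlt : perm x p₁ < perm x p := by rw [hx.perm_fst, hx.perm_snd]; exact hx.lt
  constructor
  · intro h
    have h1 := h p p₁ hx.lt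
    exact ⟨h1.gt_lt hlt, fun h2 => by rw [← h1.gt_gt hlt h2, hx.coef_fst]⟩
  · rintro ⟨h1, h2⟩ r s hrs
    rcases hx.perm_lt_or hrs with ⟨rfl, rfl⟩ | ⟨h3, h4⟩
    · exact pairDivides_of_gt hlt h1 fun h => by rw [h2 h, hx.coef_fst]
    · exact pairDivides_of_lt h3 h4

theorem IsAtom.len_eq_one {x : Geen e n} {p p₁ : Fin n} {z : ℂ} (hx : IsAtom x p p₁ z) :
    len x = 1 := by
  have key : ∀ r s, (if r < s then pairDist 1 x r s else 0) =
      if r = p then if s = p₁ then 1 else 0 else 0 := by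
    intro r s
    by_cases hrs : r < s
    · rcases hx.perm_lt_or hrs with ⟨rfl, rfl⟩ | ⟨h3, h4⟩
      · simp [pairDist, hrs, hx.perm_fst, hx.perm_snd]
      · have h5 : ¬ (r = p ∧ s = p₁) := by
          rintro ⟨rfl, rfl⟩
          rw [hx.perm_fst, hx.perm_snd] at h3
          exact h3.not_gt hx.lt
        simp [pairDist, hrs, h3.not_gt, h4]
        tauto
    · rw [if_neg hrs]
      split_ifs with h1 h2
      · exact absurd (h1 ▸ h2 ▸ hx.lt) hrs
      all_goals rfl
  simp [len, key]

theorem IsAtom.mul_self {x : Geen e n} {p p₁ : Fin n} {z : ℂ} (hx : IsAtom x p p₁ z) :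
    x * x = 1 := by
  have hz : z ≠ 0 := hx.coef_fst ▸ coef_ne_zero x p
  refine ext_perm_coef ?_ (funext fun r => ?_)
  · rw [(perm_coef_mul x x).1, hx.perm_eq, perm_one, Equiv.swap_mul_self]
  · rw [(perm_coef_mul x x).2, coef_one, hx.perm_eq]
    by_cases h1 : r = p
    · simp [h1, hx.coef_fst, hx.coef_snd, hz]
    by_cases h2 : r = p₁
    · simp [h2, hx.coef_fst, hx.coef_snd, hz]
    · simp [Equiv.swap_apply_of_ne_of_ne h1 h2, hx.coef_of_ne r h1 h2]

/-! ### Word length -/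

/-- Without inversions the permutation is trivial; the entry of the first row, on which no pair
depends, is 1 because the product of the entries is. -/
theorem eq_one_of_forall_consecutive (w : Geen e n)
    (h : ∀ p p₁ : Fin n, p₁.val = p.val + 1 → perm w p < perm w p₁ ∧ coef w p₁ = 1) : w = 1 := by
  have hmono : StrictMono (perm w) := by
    have : ∀ d : ℕ, ∀ r s : Fin n, s.val = r.val + d + 1 → perm w r < perm w s := by
      intro d
      induction d with
      | zero => exact fun r s hs => (h r s hs).1
      | succ d ih =>
        intro r s hs
        have hlt : r.val + d + 1 < n := by have := s.isLt; omega
        exact (ih r ⟨r.val + d + 1, hlt⟩ rfl).trans (h _ s (by simp only; omega)).1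
    intro r s hrs
    rw [Fin.lt_def] at hrs
    exact this (s.val - r.val - 1) r s (by omega)
  have hperm : ∀ r, perm w r = r := fun r => by
    have h1 : hmono.orderIsoOfSurjective _ (perm w).surjective = OrderIso.refl (Fin n) :=
      Subsingleton.elim _ _
    exact DFunLike.congr_fun h1 r
  have hc : ∀ r : Fin n, r.val ≠ 0 → coef w r = 1 := fun r hr =>
    (h ⟨r.val - 1, by omega⟩ r (by simp only; omega)).2
  refine ext_perm_coef (by rw [perm_one]; exact Equiv.ext hperm) (funext fun r => ?_)
  rw [coef_one]
  by_cases hr : r.val = 0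
  · rw [← prod_coef w, Finset.prod_eq_single r]
    · exact fun b _ hb => hc b fun hb0 => hb (Fin.ext (hb0.trans hr.symm))
    · simp
  · exact hc r hr

theorem exists_mem_X_pairDivides (he : 0 < e) {w : Geen e n} (hw : w ≠ 1) :
    ∃ x ∈ X e n, ∀ r s, r < s → PairDivides x w r s := by
  let B : Set (Fin n) := {p | ∃ p₁ : Fin n, p₁.val = p.val + 1 ∧
    ¬ (perm w p < perm w p₁ ∧ coef w p₁ = 1)}
  have hB : B.Nonempty := by
    by_contra hB
    refine hw (eq_one_of_forall_consecutive w fun p p₁ hp => ?_)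
    by_contra h
    exact hB ⟨p, p₁, hp, h⟩
  -- At the first bad consecutive pair, row `p` has entry 1 unless it is the first row; either way a
  -- generator with entry `coef w p` in row `p` exists.
  obtain ⟨p, ⟨p₁, hp, hbad⟩, hmin⟩ := WellFounded.has_min wellFounded_lt B hB
  have hz : coef w p = 1 ∨ p.val = 0 := by
    by_contra! h
    have hlt := p.isLt
    refine hmin ⟨p.val - 1, by omega⟩ ⟨p, by simp only; omega, fun h' => h.1 h'.2⟩ ?_
    rw [Fin.lt_def]
    simp only
    omega
  obtain ⟨x, hx, hxa⟩ := exists_mem_isAtom he hp (coef_pow w p) hz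
  refine ⟨x, hx, (hxa.pairDivides_iff w).2 ⟨fun h h' => hbad ⟨h, h'⟩, fun _ => rfl⟩⟩

theorem isSymmGenerating_X (he : 0 < e) : IsSymmGenerating (X e n) := by
  refine ⟨eq_top_iff.2 fun w _ => ?_, fun x hx => ?_⟩
  · induction h : len w using Nat.strong_induction_on generalizing w with
    | _ d ih =>
      by_cases hw : w = 1
      · exact hw ▸ one_mem _
      obtain ⟨x, hx, hxw⟩ := exists_mem_X_pairDivides he hw
      obtain ⟨p, p₁, z, hxa⟩ := exists_isAtom_of_mem hx
      have hlen := (len_eq_iff x w).2 hxw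
      rw [hxa.len_eq_one] at hlen
      rw [← mul_inv_cancel_left x w]
      exact mul_mem (Submonoid.subset_closure hx) (ih _ (by omega) _ trivial rfl)
  · obtain ⟨p, p₁, z, hxa⟩ := exists_isAtom_of_mem hx
    rwa [inv_eq_of_mul_eq_one_right hxa.mul_self]

theorem len_one : len (1 : Geen e n) = 0 := by
  have := (len_eq_iff (1 : Geen e n) 1).2 fun r s h => ⟨by simp, by simp,
    fun h' => absurd h (by simpa using h'.le), fun _ _ => rfl⟩
  simpa using this

/-- Splitting off dividing generators gives a word of length `len w`; conversely one letter raises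
`len` by at most 1. -/
theorem wordLength_eq_len (he : 0 < e) (w : Geen e n) : wordLength (X e n) w = len w := by
  have hS := isSymmGenerating_X (n := n) he
  apply le_antisymm
  · induction h : len w using Nat.strong_induction_on generalizing w with
    | _ d ih =>
      by_cases hw : w = 1
      · rw [hw, wordLength_one]; omega
      obtain ⟨x, hx, hxw⟩ := exists_mem_X_pairDivides he hw
      obtain ⟨p, p₁, z, hxa⟩ := exists_isAtom_of_mem hx
      have hlen := (len_eq_iff x w).2 hxw
      rw [hxa.len_eq_one] at hlen
      have h1 := ih _ (by omega) (x⁻¹ * w) rfl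
      have h2 := hS.wordLength_mul_le x (x⁻¹ * w)
      have h3 : wordLength (X e n) x ≤ 1 := by
        simpa using wordLength_prod_le (S := X e n) (l := [x]) (by simpa using hx)
      rw [mul_inv_cancel_left] at h2
      omega
  · obtain ⟨l, hl, rfl, hlen⟩ := hS.exists_word w
    rw [← hlen]
    clear hlen
    induction l with
    | nil => simp [len_one]
    | cons x l ih =>
      obtain ⟨p, p₁, z, hxa⟩ := exists_isAtom_of_mem (hl x (by simp))
      have h1 := len_le x (x * l.prod)
      rw [inv_mul_cancel_left, hxa.len_eq_one] at h1
      have h2 := ih fun y hy => hl y (List.mem_cons_of_mem x hy)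
      rw [List.prod_cons, List.length_cons]
      omega

theorem leftDivides_X_iff (he : 0 < e) {v w : Geen e n} :
    LeftDivides (X e n) v w ↔ ∀ r s, r < s → PairDivides v w r s := by
  rw [leftDivides_iff, wordLength_eq_len he, wordLength_eq_len he, wordLength_eq_len he,
    len_eq_iff]

/-! ### The interval -/

theorem mem_D_iff {k : ℕ} {w : Geen e n} : w ∈ D e n k ↔
    ∀ r s, r < s → perm w r < perm w s → coef w s = 1 ∨ coef w s = zeta e ^ k := by
  constructor
  · intro h r s hrs hlt
    rw [← toMatrix_perm]
    refine h s (perm w s) ((toMatrix_ne_zero_iff _ _ _).2 rfl) fun hb => ?_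
    exact (toMatrix_ne_zero_iff w r (perm w r)).2 rfl
      (hb.2 r (perm w r) hrs.le hlt.le fun h => hrs.ne (Prod.ext_iff.1 h).1)
  · intro h s c hc hb
    obtain rfl := (toMatrix_ne_zero_iff _ _ _).1 hc
    rw [toMatrix_perm]
    by_contra hs
    refine hb ⟨hc, fun r c hr hcs hne => ?_⟩
    by_contra h0
    obtain rfl := (toMatrix_ne_zero_iff _ _ _).1 h0
    have hrs : r ≠ s := fun h => hne (by rw [h])
    exact hs (h r s (hr.lt_of_ne hrs) (hcs.lt_of_ne ((perm w).injective.ne hrs)))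

theorem perm_coef_lam_pow (k : ℕ) : perm (lam e n ^ k) = 1 ∧
    ∀ r, r.val ≠ 0 → coef (lam e n ^ k) r = zeta e ^ k := by
  obtain ⟨h1, h2⟩ := perm_coef_ofExponents (e := e) (1 : Equiv.Perm (Fin n))
    (fun r => if r.val = 0 then 1 - (n : ℤ) else 1) (by
      rcases n with _ | n
      · simp
      · simp [Fin.sum_univ_succ])
  change perm (lam e n) = 1 at h1
  change coef (lam e n) = _ at h2
  induction k with
  | zero => simp
  | succ k ih =>
    rw [pow_succ, (perm_coef_mul _ _).1, (perm_coef_mul _ _).2, ih.1, h1]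
    refine ⟨rfl, fun r hr => ?_⟩
    simp [ih.2 r hr, h2, hr, pow_succ]

theorem lam_pow_self : lam e n ^ e = 1 := by
  have h : ∀ k, perm (lam e n ^ k) = 1 ∧ ∀ r, coef (lam e n ^ k) r = coef (lam e n) r ^ k := by
    intro k
    induction k with
    | zero => simp
    | succ k ih =>
      rw [pow_succ, (perm_coef_mul _ _).1, (perm_coef_mul _ _).2, ih.1]
      have h1 := (perm_coef_lam_pow (e := e) (n := n) 1).1
      rw [pow_one] at h1
      exact ⟨by rw [h1]; rfl, fun r => by simp only [ih.2, pow_succ, Equiv.Perm.one_apply]⟩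
  refine ext_perm_coef (by rw [(h e).1, perm_one]) (funext fun r => ?_)
  rw [(h e).2, coef_pow, coef_one]

theorem inv_lam_pow {k : ℕ} (hk : k ≤ e) : (lam e n ^ k)⁻¹ = lam e n ^ (e - k) :=
  inv_eq_of_mul_eq_one_right (by rw [← pow_add, Nat.add_sub_cancel' hk, lam_pow_self])

theorem zeta_pow_ne_one {k : ℕ} (hk : 1 ≤ k) (hke : k < e) : zeta e ^ k ≠ 1 :=
  (Complex.isPrimitiveRoot_exp e (by omega)).pow_ne_one_of_pos_of_lt (by omega) hke

/-- `λ^k` inverts no pair, and the later row of a pair is never the first, so its entry is `ζ_e^k ≠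
1`. Of the four clauses of `PairDivides` only `lt_lt` imposes a condition. -/
theorem leftInterval_eq_D {k : ℕ} (hk : 1 ≤ k) (hke : k < e) :
    leftInterval (X e n) (lam e n ^ k) = D e n k := by
  ext w
  have hne := zeta_pow_ne_one hk hke
  rw [mem_leftInterval, leftDivides_X_iff (by omega), mem_D_iff]
  obtain ⟨h1, h2⟩ := perm_coef_lam_pow (e := e) (n := n) k
  refine forall_congr' fun r => forall_congr' fun s => forall_congr' fun hrs => ?_
  have hs : coef (lam e n ^ k) s = zeta e ^ k := h2 s (by rw [Fin.lt_def] at hrs; omega)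
  constructor
  · intro h hlt
    simpa [hs] using h.lt_lt hlt (by simpa [h1] using hrs)
  · intro h
    refine ⟨fun hlt _ => by simpa [hs] using h hlt, fun _ h' => ?_, fun _ _ => by rwa [hs],
      fun _ h' => ?_⟩ <;> exact absurd hrs (by simpa [h1] using h'.le)

/-- Passing to `w⁻¹` exchanges rows with columns, which preserves non-inverted pairs, and inverts
the entries. -/
theorem isBalanced_lam_pow {k : ℕ} (hk : 1 ≤ k) (hke : k < e) :
    IsBalanced (X e n) (lam e n ^ k) := by
  ext w
  rw [(isSymmGenerating_X (by omega)).mem_rightInterval, inv_lam_pow hke.le,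
    leftInterval_eq_D hk hke, leftInterval_eq_D (by omega) (by omega), mem_D_iff, mem_D_iff]
  have hz : zeta e ^ (e - k) = (zeta e ^ k)⁻¹ := by
    refine eq_inv_of_mul_eq_one_left ?_
    rw [← pow_add, Nat.sub_add_cancel hke.le, zeta_pow]
  have hc : ∀ s, (coef w⁻¹ (perm w s) = 1 ∨ coef w⁻¹ (perm w s) = zeta e ^ (e - k)) ↔
      (coef w s = 1 ∨ coef w s = zeta e ^ k) := fun s => by
    rw [coef_inv, hz, inv_inj, inv_eq_one]
  constructor
  · intro h p q hpq hlt
    obtain ⟨r, rfl⟩ := (perm w).surjective p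
    obtain ⟨s, rfl⟩ := (perm w).surjective q
    simp only [perm_inv, Equiv.Perm.inv_def, Equiv.symm_apply_apply] at hlt
    exact (hc s).2 (h r s hlt hpq)
  · intro h r s hrs hlt
    exact (hc s).1 (h _ _ hlt (by simpa [perm_inv] using hrs))

theorem finite_Geen (he : 0 < e) : Finite (Geen e n) := by
  have := NeZero.of_pos he
  have h : ∀ (w : Geen e n) r, ∃ i : Fin e, zeta e ^ i.val = coef w r := fun w r => by
    obtain ⟨i, hi, hiz⟩ := (Complex.isPrimitiveRoot_exp e he.ne').eq_pow_of_pow_eq_one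
      (coef_pow w r)
    exact ⟨⟨i, hi⟩, hiz⟩
  choose f hf using h
  refine Finite.of_injective (fun w => (perm w, f w)) fun v w hvw => ?_
  obtain ⟨h1, h2⟩ := Prod.ext_iff.1 hvw
  refine ext_perm_coef h1 (funext fun r => ?_)
  rw [← hf, ← hf, show f v = f w from h2]

/-! ### Joins of generators -/

/-- There is an element with underlying permutation `σ` and with entries `z` and `z⁻¹` in the rows
`i` and `j`, and `1` elsewhere. -/
theorem exists_perm_coef (σ : Equiv.Perm (Fin n)) {i j : Fin n} (hij : i ≠ j) (he : 0 < e) {z : ℂ}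
    (hz : z ^ e = 1) : ∃ w : Geen e n, perm w = σ ∧ coef w i = z ∧ coef w j = z⁻¹ ∧
      ∀ r, r ≠ i → r ≠ j → coef w r = 1 := by
  have := NeZero.of_pos he
  obtain ⟨m, -, hm⟩ := (Complex.isPrimitiveRoot_exp e he.ne').eq_pow_of_pow_eq_one hz
  have hsum : ∑ r, (if r = i then (m : ℤ) else if r = j then -(m : ℤ) else 0) = 0 := by
    have h : ∀ r, (if r = i then (m : ℤ) else if r = j then -(m : ℤ) else 0) =
        (if r = i then (m : ℤ) else 0) + if r = j then -(m : ℤ) else 0 := by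
      intro r
      by_cases h : r = i <;> simp [h, hij]
    simp_rw [h, Finset.sum_add_distrib]
    simp
  obtain ⟨h1, h2⟩ := perm_coef_ofExponents (e := e) σ _ hsum
  refine ⟨_, h1, ?_, ?_, fun r hr hr' => ?_⟩ <;> rw [h2]
  · simpa [zeta] using hm
  · simpa [zeta, hij.symm] using hm
  · simp [hr, hr']

theorem exists_join_of_le {k : ℕ} (hk : 1 ≤ k) (hke : k < e) {x y : Geen e n} {p p₁ q q₁ : Fin n}
    {z z' : ℂ} (hx : IsAtom x p p₁ z) (hy : IsAtom y q q₁ z') (hpq : p ≤ q) :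
    ∃ m, IsJoinOn (LeftDivides (X e n)) (leftInterval (X e n) (lam e n ^ k)) x y m := by
  have he : 0 < e := by omega
  have hne := zeta_pow_ne_one hk hke
  simp only [leftInterval_eq_D hk hke, IsJoinOn, leftDivides_X_iff he, hx.pairDivides_iff,
    hy.pairDivides_iff, mem_D_iff]
  have hp := hx.val_eq
  have hq := hy.val_eq
  have hlt := hx.lt
  have hlt' := hy.lt
  have hze : z ^ e = 1 := hx.coef_fst ▸ coef_pow x p
  rw [Fin.le_def] at hpq
  rcases hpq.eq_or_lt with h | h
  · obtain rfl : p = q := Fin.ext h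
    obtain rfl : p₁ = q₁ := Fin.ext (by omega)
    by_cases hzz : z = z'
    · subst hzz
      refine ⟨x, fun r s hrs hlt₀ => ?_, ?_, ?_, fun w _ h _ => (hx.pairDivides_iff w).2 h⟩
      · rcases hx.perm_lt_or hrs with ⟨rfl, rfl⟩ | ⟨-, h'⟩
        · rw [hx.perm_fst, hx.perm_snd] at hlt₀
          exact absurd hlt₀ hlt.not_gt
        · exact Or.inl h'
      all_goals
        rw [hx.perm_fst, hx.perm_snd]
        exact ⟨fun h => absurd h hlt.not_gt, fun _ => hx.coef_fst⟩
    · have hp0 : p.val = 0 := by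
        by_contra h0
        exact hzz ((hx.eq_one_or.resolve_right h0).trans (hy.eq_one_or.resolve_right h0).symm)
      -- A common multiple cannot invert the first two rows, since its first entry would be both `z`
      -- and `z'`. In `D_k` its second entry is then `ζ_e^k`, and the diagonal matrix with
      -- `ζ_e^{-k}`, `ζ_e^k` in these rows is the join.
      obtain ⟨m, h1, h2, -, h3⟩ := exists_perm_coef 1 hlt.ne' he
        (show (zeta e ^ k) ^ e = 1 by rw [← pow_mul, mul_comm, pow_mul, zeta_pow, one_pow])
      have h4 : ∀ s : Fin n, s.val ≠ 0 → s ≠ p₁ → coef m s = 1 := fun s hs hs' =>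
        h3 s hs' fun h => hs (h ▸ hp0)
      have hm : ∀ r s : Fin n, r < s → (r = p ∧ s = p₁) ∨ coef m s = 1 := by
        intro r s hrs
        rw [Fin.lt_def] at hrs
        by_cases hs : s = p₁
        · exact Or.inl ⟨Fin.ext (by rw [hs] at hrs; omega), hs⟩
        · exact Or.inr (h4 s (by omega) hs)
      refine ⟨m, fun r s hrs _ => ?_, ?_, ?_, fun w hw hxw hyw r s hrs => ?_⟩
      · rcases hm r s hrs with ⟨-, rfl⟩ | h
        · exact Or.inr h2
        · exact Or.inl h
      · rw [h1]
        exact ⟨fun _ => by rwa [h2], fun h => absurd h hlt.not_gt⟩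
      · rw [h1]
        exact ⟨fun _ => by rwa [h2], fun h => absurd h hlt.not_gt⟩
      · rcases hm r s hrs with ⟨rfl, rfl⟩ | h
        · rcases ((perm w).injective.ne hrs.ne).lt_or_gt with h' | h'
          · have h5 := (hw r s hrs h').resolve_left (hxw.1 h')
            refine ⟨fun _ _ => Or.inr (h2.trans h5.symm), fun _ h => absurd h h'.not_gt,
              fun _ _ => hxw.1 h', fun _ h => absurd h h'.not_gt⟩
          · exact absurd ((hxw.2 h').symm.trans (hyw.2 h')) hzz
        · exact pairDivides_of_lt (by rwa [h1]) h
  have hz' : z' = 1 := hy.eq_one_or.resolve_right (by omega)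
  subst hz'
  by_cases h' : q.val = p.val + 1
  · obtain rfl : q = p₁ := Fin.ext (by omega)
    have hpq₁ : p < q₁ := hlt.trans hlt'
    -- Overlapping generators: the join reverses the three consecutive rows `p`, `q`, `q₁`, keeping
    -- the entry `z` in row `p`.
    obtain ⟨m, h1, h2, h3, h4⟩ := exists_perm_coef (Equiv.swap p q₁) hpq₁.ne he hze
    have hmp : perm m p = q₁ := by simp [h1]
    have hmq : perm m q = q := by rw [h1, Equiv.swap_apply_of_ne_of_ne hlt.ne' hlt'.ne]
    have hmq₁ : perm m q₁ = p := by simp [h1]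
    have hm : ∀ r s : Fin n, r < s → ((r = p ∧ s = q) ∨ (r = q ∧ s = q₁) ∨ (r = p ∧ s = q₁)) ∨
        (perm m r < perm m s ∧ coef m s = 1) := by
      intro r s hrs
      by_cases hcase : (r = p ∧ s = q) ∨ (r = q ∧ s = q₁) ∨ (r = p ∧ s = q₁)
      · exact Or.inl hcase
      refine Or.inr ⟨?_, ?_⟩
      · rw [h1]
        simp only [Equiv.swap_apply_def]
        split_ifs <;> simp only [Fin.ext_iff, Fin.lt_def] at * <;> omega
      · rcases hx.eq_one_or with rfl | h0
        · by_cases hs : s = p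
          · rw [hs, h2]
          by_cases hs' : s = q₁
          · rw [hs', h3, inv_one]
          exact h4 s hs hs'
        · simp only [Fin.ext_iff, Fin.lt_def] at *
          refine h4 s (fun h => ?_) fun h => ?_ <;> rw [Fin.ext_iff] at h <;> omega
    refine ⟨m, fun r s hrs hlt₀ => ?_, ?_, ?_, fun w hw hxw hyw r s hrs => ?_⟩
    · rcases hm r s hrs with (⟨rfl, rfl⟩ | ⟨rfl, rfl⟩ | ⟨rfl, rfl⟩) | ⟨-, h'⟩
      · rw [hmp, hmq] at hlt₀
        exact absurd hlt₀ hlt'.not_gt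
      · rw [hmq, hmq₁] at hlt₀
        exact absurd hlt₀ hlt.not_gt
      · rw [hmp, hmq₁] at hlt₀
        exact absurd hlt₀ hpq₁.not_gt
      · exact Or.inl h'
    · rw [hmp, hmq]
      exact ⟨fun h => absurd h hlt'.not_gt, fun _ => h2⟩
    · rw [hmq, hmq₁]
      exact ⟨fun h => absurd h hlt.not_gt, fun _ => h4 q hlt.ne' hlt'.ne⟩
    · have hwq := ((perm w).injective.ne hlt'.ne).lt_or_gt
      have hwp := ((perm w).injective.ne hlt.ne).lt_or_gt
      rcases hm r s hrs with (⟨rfl, rfl⟩ | ⟨rfl, rfl⟩ | ⟨rfl, rfl⟩) | ⟨h5, h6⟩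
      · exact pairDivides_of_gt (by rwa [hmp, hmq]) hxw.1 fun h => h2.trans (hxw.2 h).symm
      · exact pairDivides_of_gt (by rwa [hmq, hmq₁]) hyw.1 fun h =>
          (h4 r hlt.ne' hlt'.ne).trans (hyw.2 h).symm
      -- The outer pair is controlled by the middle row `q`: the bad positions of it would force its
      -- entry to be both 1 and different from 1.
      · refine pairDivides_of_gt (by rwa [hmp, hmq₁]) (fun h => ?_) fun h => ?_
        · rcases hwq with h5 | h5
          · exact hyw.1 h5
          · exact absurd (hyw.2 h5) (hxw.1 (h.trans h5))
        · rcases hwp with h5 | h5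
          · exact absurd (hyw.2 (h.trans h5)) (hxw.1 h5)
          · exact h2.trans (hxw.2 h5).symm
      · exact pairDivides_of_lt h5 h6
  -- Disjoint generators: the join performs both exchanges.
  · obtain ⟨m, h1, h2, h3, h4⟩ :=
      exists_perm_coef (Equiv.swap q q₁ * Equiv.swap p p₁) hlt.ne he hze
    have hqp : q ≠ p := fun h => by rw [Fin.ext_iff] at h; omega
    have hqp₁ : q ≠ p₁ := fun h => by rw [Fin.ext_iff] at h; omega
    have hq₁p : q₁ ≠ p := fun h => by rw [Fin.ext_iff] at h; omega
    have hq₁p₁ : q₁ ≠ p₁ := fun h => by rw [Fin.ext_iff] at h; omega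
    have hmp : perm m p = p₁ := by
      simp [h1, Equiv.swap_apply_of_ne_of_ne hqp₁.symm hq₁p₁.symm]
    have hmp₁ : perm m p₁ = p := by
      simp [h1, Equiv.swap_apply_of_ne_of_ne hqp.symm hq₁p.symm]
    have hmq : perm m q = q₁ := by
      simp [h1, Equiv.swap_apply_of_ne_of_ne hqp hqp₁]
    have hmq₁ : perm m q₁ = q := by
      simp [h1, Equiv.swap_apply_of_ne_of_ne hq₁p hq₁p₁]
    have hm : ∀ r s : Fin n, r < s → ((r = p ∧ s = p₁) ∨ (r = q ∧ s = q₁)) ∨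
        (perm m r < perm m s ∧ coef m s = 1) := by
      intro r s hrs
      by_cases hcase : (r = p ∧ s = p₁) ∨ (r = q ∧ s = q₁)
      · exact Or.inl hcase
      refine Or.inr ⟨?_, ?_⟩
      · have hrs' := (swap_lt_swap hp hrs).resolve_left fun h => hcase (Or.inl h)
        rw [h1, Equiv.Perm.mul_apply, Equiv.Perm.mul_apply]
        refine (swap_lt_swap hq hrs').resolve_left fun ⟨h5, h6⟩ => hcase (Or.inr ⟨?_, ?_⟩)
        · rw [Equiv.swap_apply_eq_iff] at h5
          rw [h5, Equiv.swap_apply_of_ne_of_ne hqp hqp₁]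
        · rw [Equiv.swap_apply_eq_iff] at h6
          rw [h6, Equiv.swap_apply_of_ne_of_ne hq₁p hq₁p₁]
      · rcases hx.eq_one_or with rfl | h0
        · by_cases hs : s = p
          · rw [hs, h2]
          by_cases hs' : s = p₁
          · rw [hs', h3, inv_one]
          exact h4 s hs hs'
        · simp only [Fin.ext_iff, Fin.lt_def] at *
          refine h4 s (fun h => ?_) fun h => ?_ <;> rw [Fin.ext_iff] at h <;> omega
    refine ⟨m, fun r s hrs hlt₀ => ?_, ?_, ?_, fun w hw hxw hyw r s hrs => ?_⟩
    · rcases hm r s hrs with (⟨rfl, rfl⟩ | ⟨rfl, rfl⟩) | ⟨-, h'⟩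
      · rw [hmp, hmp₁] at hlt₀
        exact absurd hlt₀ hlt.not_gt
      · rw [hmq, hmq₁] at hlt₀
        exact absurd hlt₀ hlt'.not_gt
      · exact Or.inl h'
    · rw [hmp, hmp₁]
      exact ⟨fun h => absurd h hlt.not_gt, fun _ => h2⟩
    · rw [hmq, hmq₁]
      exact ⟨fun h => absurd h hlt'.not_gt, fun _ => h4 q hqp hqp₁⟩
    · rcases hm r s hrs with (⟨rfl, rfl⟩ | ⟨rfl, rfl⟩) | ⟨h5, h6⟩
      · exact pairDivides_of_gt (by rwa [hmp, hmp₁]) hxw.1 fun h => h2.trans (hxw.2 h).symm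
      · exact pairDivides_of_gt (by rwa [hmq, hmq₁]) hyw.1 fun h =>
          (h4 r hqp hqp₁).trans (hyw.2 h).symm
      · exact pairDivides_of_lt h5 h6

theorem isLatticeOn_leftInterval {k : ℕ} (hk : 1 ≤ k) (hke : k < e) :
    IsLatticeOn (LeftDivides (X e n)) (leftInterval (X e n) (lam e n ^ k)) := by
  refine (isSymmGenerating_X (by omega)).isLatticeOn_leftInterval (isBalanced_lam_pow hk hke)
    fun x hx y hy _ _ => ?_
  obtain ⟨p, p₁, z, hxa⟩ := exists_isAtom_of_mem hx
  obtain ⟨q, q₁, z', hya⟩ := exists_isAtom_of_mem hy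
  rcases le_total p q with h | h
  · exact exists_join_of_le hk hke hxa hya h
  · obtain ⟨m, h1, h2, h3, h4⟩ := exists_join_of_le hk hke hya hxa h
    exact ⟨m, h1, h3, h2, fun c hc hxc hyc => h4 c hc hyc hxc⟩

theorem isGarsideInterval_lam_pow {k : ℕ} (hk : 1 ≤ k) (hke : k < e) :
    IsGarsideInterval (X e n) (lam e n ^ k) :=
  ⟨isSymmGenerating_X (by omega), isBalanced_lam_pow hk hke, isLatticeOn_leftInterval hk hke, by
    rw [inv_lam_pow hke.le]
    exact isLatticeOn_leftInterval (by omega) (by omega)⟩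

end Geen

/-! ### Assembly of the theorem -/

theorem mainTheorem1 (e n k : ℕ) (hn : 1 ≤ n) (hk : 1 ≤ k) (hke : k ≤ e - 1) :
    Submonoid.closure (Geen.X e n) = ⊤ ∧
    leftInterval (Geen.X e n) (Geen.lam e n ^ k) = Geen.D e n k ∧
    IsBalanced (Geen.X e n) (Geen.lam e n ^ k) ∧
    IsLatticeOn (LeftDivides (Geen.X e n)) (leftInterval (Geen.X e n) (Geen.lam e n ^ k)) ∧
    IsLatticeOn (RightDivides (Geen.X e n)) (rightInterval (Geen.X e n) (Geen.lam e n ^ k)) ∧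
    IsGarsideMonoid (IntervalMonoid (Geen.X e n) (Geen.lam e n ^ k)) ∧
    IsGarsideElement (IntervalMonoid.copy (Geen.X e n) (Geen.lam e n ^ k)
      ⟨Geen.lam e n ^ k, self_mem_leftInterval (Geen.X e n) (Geen.lam e n ^ k)⟩) ∧
    Function.Injective (IntervalMonoid.copy (Geen.X e n) (Geen.lam e n ^ k)) ∧
    {x | IsLeftDivisor x (IntervalMonoid.copy (Geen.X e n) (Geen.lam e n ^ k)
      ⟨Geen.lam e n ^ k, self_mem_leftInterval (Geen.X e n) (Geen.lam e n ^ k)⟩)} =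
      Set.range (IntervalMonoid.copy (Geen.X e n) (Geen.lam e n ^ k)) ∧
    ∃ (Γ : Type) (_ : Group Γ) (ι : IntervalMonoid (Geen.X e n) (Geen.lam e n ^ k) →* Γ),
      IsGroupOfFractions ι := by
  have hlt : k < e := by omega
  have H := Geen.isGarsideInterval_lam_pow (n := n) hk hlt
  have hc := IntervalMonoid.isIntervalPresentation (Geen.X e n) (Geen.lam e n ^ k)
  have : Finite (Geen e n) := Geen.finite_Geen (by omega)
  have hfin := Set.toFinite (leftInterval (Geen.X e n) (Geen.lam e n ^ k))
  have hM := hc.isGarsideMonoid H hfin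
  rw [← IntervalMonoid.copyExt_eq]
  refine ⟨H.closure_eq, Geen.leftInterval_eq_D hk hlt, H.balanced, H.lattice,
    H.isLatticeOn_rightInterval H.lattice_inv, hM, hc.isGarsideElement H hfin,
    fun f g hfg => ?_, ?_, hM.exists_isGroupOfFractions⟩
  · refine Subtype.ext (hc.copy_injOn f.2 g.2 ?_)
    rwa [IntervalMonoid.copyExt_eq f.2, IntervalMonoid.copyExt_eq g.2]
  · rw [(hc.divisors_eq H).1]
    ext m
    constructor
    · rintro ⟨f, hf, rfl⟩
      exact ⟨⟨f, hf⟩, (IntervalMonoid.copyExt_eq hf).symm⟩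
    · rintro ⟨f, rfl⟩
      exact ⟨f, f.2, IntervalMonoid.copyExt_eq f.2⟩
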